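/- Let $f:\mathbb{R}^{n}\times\mathbb{R}^{m}\to\mathbb{R}^{n}$ with $f(0,0)=0$, let $\kappa:\mathbb{R}^{n}\to\mathbb{R}^{m}$, and fix $c>0$, $\sigma\in(0,1)$, $\nu\in\mathbb{N}$, $\nu\ge 1$. All norms are Euclidean. A class $\mathcal{K}$ function is a continuous, strictly increasing $\alpha:[0,\infty)\to[0,\infty)$ with $\alpha(0)=0$. Let $V:\mathbb{R}^{n}\to\mathbb{R}$ be continuous with $V(0)=0$ and $V(x)>0$ for $x\neq 0$, put $\mathcal{X}_c=\{x : V(x)\le c\}$, and assume: 1. $V$ is differentiable at every point of $\mathcal{X}_c$, and there are class $\mathcal{K}$ functions $\alpha_1,\alpha_2,\gamma$ with $\alpha_1(\|x\|)\le V(x)\le\alpha_2(\|x\|)$ and $V'(x)f(x,\kappa(x))\le-\gamma(V(x))$ for all $x\in\mathcal{X}_c$. 2. $L_{1,c}:=\sup\left\{\frac{\|f(x_1,\kappa(x_3))-f(x_2,\kappa(x_3))\|}{\|x_1-x_2\|} : x_1,x_2,x_3\in\mathcal{X}_c,\ x_1\ne x_2\right\}<\infty$. 3. $L_{2,c}:=\sup\left\{\frac{\|V'(x_1)-V'(x_2)\|}{\|x_1-x_2\|}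 : x_1,x_2\in\mathcal{X}_c,\ x_1\ne x_2\right\}<\infty$. 4. There is a (not necessarily continuous) function $M_c:\mathbb{R}^n\to\mathbb{R}$, bounded on $\mathcal{X}_c$, with $M_c(0)=0$, $M_c(x)>0$ for $x\ne 0$, and $\|V'(x)\|\,\|f(x,\kappa(x))\|+\|f(x,\kappa(x))\|^2\le M_c(x)\,|V'(x)f(x,\kappa(x))|$ for all $x\in\mathcal{X}_c$. Put $\mu_c=\sqrt{e}\,\max\{L_{1,c},\,L_{2,c}(1+L_{1,c}\sqrt{e})\}$, $M_{\max,c}=\sup_{x\in\mathcal{X}_c}M_c(x)$, and let the sampling period $h>0$ satisfy $$h\le h_{\sigma\text{-MASP}}:=\min\left\{\left(\frac{3(1-\sigma)}{2\mu_cM_{\max,c}}\right)^2,\ \frac{1}{1+2L_{1,c}}\right\}.$$ Let $f_p:\mathbb{R}^n\to\mathbb{R}^n$ be an arbitrary continuously differentiable map with $f_p(0)=0$. The closed loop has state $\xi=(x,\hat x)$, with $\xi(0)=(x_0,x_0)$. On each interval $[kh,(k+1)h)$, $k\ge 0$, it satisfies $\dot x(t)=f(x(t),\kappa(\hat x(t)))$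 and $\dot{\hat x}(t)=0$. The component $x$ is continuous, and at each time $t=(k+1)h$ one has $\hat x(t)=x(t)$ if the state is transmitted at $t$, and $\hat x(t)=f_p(\hat x(kh))$ otherwise. Transmissions are decided by the following mechanism. At $k=0$ transmit and set $i^{\rm ref}=0$, $V^{\rm ref}=V(x_0)$, $\hat x^{\rm sens}=x_0$. At $k\ge1$ replace $\hat x^{\rm sens}$ by $f_p(\hat x^{\rm sens})$, put $u=\kappa(\hat x^{\rm sens})$, $y=x(kh)$ and $$\lambda_k=h\,V'(y)f(y,u)+\tfrac23h^{3/2}\mu_c\left(\|V'(y)\|\,\|f(y,u)\|+\|f(y,u)\|^2\right);$$ if $k-i^{\rm ref}>\nu$, or $V(\hat x^{\rm sens})>c$, or $V(y)+\lambda_k\ge V^{\rm ref}-(k-i^{\rm ref}+1)\,h\,\sigma\,\gamma(V^{\rm ref})$, then transmit $y$ and set $i^{\rm ref}=k$, $V^{\rm ref}=V(y)$, $\hat x^{\rm sens}=y$; otherwise do not transmit. Then the origin of the closed loop is locally asymptotically stable with region of attraction $\mathcal{X}_c$. That is, $\mathcal{X}_c$ is a neighbourhood of $0$; for every $x_0\in\mathcal{X}_c$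 a closed-loop trajectory on $[0,\infty)$ exists; for every $\varepsilon>0$ there is $\delta>0$ such that every closed-loop trajectory with $\|\xi(0)\|\le\delta$ satisfies $\|\xi(t)\|\le\varepsilon$ for all $t\ge0$; and $\xi(t)\to0$ as $t\to\infty$ for every closed-loop trajectory with $x_0\in\mathcal{X}_c$. Moreover, for every $x_0\in\mathcal{X}_c$ and every closed-loop trajectory from $x_0$, the averaged convergence criterion $$V(x(t+h))\le S(t,x_0)\quad\text{for all } t>0$$ holds, where $S(\cdot,x_0)\ge 0$ is the solution on $[0,\infty)$ of $\frac{d}{dt}S=-\sigma\gamma(S)$, $S(0,x_0)=V(x_0)$. -/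

import Mathlib

open Set Filter Topology

noncomputable section

namespace PETC

/-- Euclidean `n`-space. -/
abbrev Vec (n : ℕ) := EuclideanSpace ℝ (Fin n)

/-- The state space of the pair `ξ = (x, x̂)`, with the Euclidean norm of `ℝ²ⁿ`. -/
abbrev PairState (n : ℕ) := WithLp 2 (Vec n × Vec n)

/-- The pair `ξ = (x, x̂)`. -/
def pair {n : ℕ} (x xhat : Vec n) : PairState n := WithLp.toLp 2 (x, xhat)

/-- Class `𝒦` functions; only the values on `[0, ∞)` matter. -/
structure IsClassK (α : ℝ → ℝ) : Prop where
  continuousOn : ContinuousOn α (Ici 0)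
  strictMonoOn : StrictMonoOn α (Ici 0)
  map_zero : α 0 = 0

/-- The level set `𝒳_c = {x | V x ≤ c}`. -/
def levelSet {n : ℕ} (V : Vec n → ℝ) (c : ℝ) : Set (Vec n) := {x | V x ≤ c}

/-- The Lie derivative `V'(x) f(x,u)`. -/
def lieDeriv {n m : ℕ} (f : Vec n → Vec m → Vec n) (V : Vec n → ℝ) (x : Vec n) (u : Vec m) : ℝ :=
  fderiv ℝ V x (f x u)

/-- `V` is a control Lyapunov function with feedback law `κ` on the level set `𝒳_c`. -/
structure LyapunovAssumption {n m : ℕ} (f : Vec n → Vec m → Vec n) (κ : Vec n → Vec m)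
    (V : Vec n → ℝ) (α₁ α₂ γ : ℝ → ℝ) (c : ℝ) : Prop where
  classK_α₁ : IsClassK α₁
  classK_α₂ : IsClassK α₂
  classK_γ : IsClassK γ
  continuous : Continuous V
  map_zero : V 0 = 0
  pos : ∀ x, x ≠ 0 → 0 < V x
  lower : ∀ x ∈ levelSet V c, α₁ ‖x‖ ≤ V x
  upper : ∀ x ∈ levelSet V c, V x ≤ α₂ ‖x‖
  differentiableAt : ∀ x ∈ levelSet V c, DifferentiableAt ℝ V x
  decrease : ∀ x ∈ levelSet V c, lieDeriv f V x (κ x) ≤ -γ (V x)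

/-- The difference quotients of `x ↦ f(x, κ(x₃))` over the level set. -/
def quotients₁ {n m : ℕ} (f : Vec n → Vec m → Vec n) (κ : Vec n → Vec m) (V : Vec n → ℝ) (c : ℝ) :
    Set ℝ :=
  {r | ∃ x₁ ∈ levelSet V c, ∃ x₂ ∈ levelSet V c, ∃ x₃ ∈ levelSet V c, x₁ ≠ x₂ ∧
    r = ‖f x₁ (κ x₃) - f x₂ (κ x₃)‖ / ‖x₁ - x₂‖}

/-- The difference quotients of `V'` over the level set. -/
def quotients₂ {n : ℕ} (V : Vec n → ℝ) (c : ℝ) : Set ℝ :=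
  {r | ∃ x₁ ∈ levelSet V c, ∃ x₂ ∈ levelSet V c, x₁ ≠ x₂ ∧
    r = ‖fderiv ℝ V x₁ - fderiv ℝ V x₂‖ / ‖x₁ - x₂‖}

/-- The Lipschitz constant `L_{1,c}` (meaningful when `quotients₁` is bounded above). -/
def L₁ {n m : ℕ} (f : Vec n → Vec m → Vec n) (κ : Vec n → Vec m) (V : Vec n → ℝ) (c : ℝ) : ℝ :=
  sSup (quotients₁ f κ V c)

/-- The Lipschitz constant `L_{2,c}` (meaningful when `quotients₂` is bounded above). -/
def L₂ {n : ℕ} (V : Vec n → ℝ) (c : ℝ) : ℝ := sSup (quotients₂ V c)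

/-- `M` vanishes exactly at the origin, is positive elsewhere, is bounded on `𝒳_c`, and satisfies
the growth inequality there. -/
structure GrowthAssumption {n m : ℕ} (f : Vec n → Vec m → Vec n) (κ : Vec n → Vec m)
    (V : Vec n → ℝ) (M : Vec n → ℝ) (c : ℝ) : Prop where
  map_zero : M 0 = 0
  pos : ∀ x, x ≠ 0 → 0 < M x
  bddAbove : BddAbove (M '' levelSet V c)
  growth : ∀ x ∈ levelSet V c,
    ‖fderiv ℝ V x‖ * ‖f x (κ x)‖ + ‖f x (κ x)‖ ^ 2 ≤ M x * |lieDeriv f V x (κ x)|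

/-- `μ_c = √e · max {L_{1,c}, L_{2,c} (1 + L_{1,c} √e)}`. -/
def mu {n m : ℕ} (f : Vec n → Vec m → Vec n) (κ : Vec n → Vec m) (V : Vec n → ℝ) (c : ℝ) : ℝ :=
  √(Real.exp 1) * max (L₁ f κ V c) (L₂ V c * (1 + L₁ f κ V c * √(Real.exp 1)))

/-- The bound `h_{σ-MASP}` on the sampling period. -/
def hMASP {n m : ℕ} (f : Vec n → Vec m → Vec n) (κ : Vec n → Vec m) (V : Vec n → ℝ)
    (M : Vec n → ℝ) (c σ : ℝ) : ℝ :=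
  min ((3 * (1 - σ) / (2 * mu f κ V c * sSup (M '' levelSet V c))) ^ 2)
    ((1 + 2 * L₁ f κ V c)⁻¹)

/-- `S` solves `dS/dt = -σ γ(S)`, `S(0) = S₀` on `[0, ∞)`, with values in the domain `[0, ∞)`
of `γ`. -/
structure IsComparisonSolution (γ : ℝ → ℝ) (σ S₀ : ℝ) (S : ℝ → ℝ) : Prop where
  init : S 0 = S₀
  nonneg : ∀ t, 0 ≤ t → 0 ≤ S t
  hasDeriv : ∀ t, 0 ≤ t → HasDerivWithinAt S (-(σ * γ (S t))) (Ici 0) t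

/-- The memory of the trigger mechanism after a sampling instant, together with the decision
taken there. -/
structure TriggerState (n : ℕ) where
  /-- index of the last transmission -/
  iref : ℕ
  /-- value of `V` at the last transmission -/
  Vref : ℝ
  /-- copy of the prediction -/
  xsens : Vec n
  /-- whether the state was transmitted at this sampling instant -/
  transmit : Prop

/-- The quantity `λ_k` for the sample `y = x(kh)` and the input `u`. -/
def lam {n m : ℕ} (f : Vec n → Vec m → Vec n) (κ : Vec n → Vec m) (V : Vec n → ℝ)
    (c h : ℝ) (y : Vec n) (u : Vec m) : ℝ :=
  h * lieDeriv f V y u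
    + 2 / 3 * h ^ (3 / 2 : ℝ) * mu f κ V c * (‖fderiv ℝ V y‖ * ‖f y u‖ + ‖f y u‖ ^ 2)

/-- The trigger rule at `t = kh`, for the sample `y = x(kh)`, the updated copy `xs` of the
prediction, and the memory `iref`, `Vref`. -/
def triggers {n m : ℕ} (f : Vec n → Vec m → Vec n) (κ : Vec n → Vec m) (V : Vec n → ℝ)
    (γ : ℝ → ℝ) (c σ h : ℝ) (ν k iref : ℕ) (Vref : ℝ) (y xs : Vec n) : Prop :=
  (ν : ℝ) < (k : ℝ) - iref ∨ c < V xs ∨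
    Vref - ((k : ℝ) - iref + 1) * h * σ * γ Vref ≤ V y + lam f κ V c h y (κ xs)

open Classical in
/-- The trigger mechanism run on the samples `y k = x(kh)`; the value at `k` is the memory and
the decision after the sampling instant `kh`. -/
def triggerRun {n m : ℕ} (f : Vec n → Vec m → Vec n) (κ : Vec n → Vec m) (fp : Vec n → Vec n)
    (V : Vec n → ℝ) (γ : ℝ → ℝ) (c σ h : ℝ) (ν : ℕ) (y : ℕ → Vec n) : ℕ → TriggerState n
  | 0 => ⟨0, V (y 0), y 0, True⟩
  | k + 1 =>
    let s := triggerRun f κ fp V γ c σ h ν y k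
    if triggers f κ V γ c σ h ν (k + 1) s.iref s.Vref (y (k + 1)) (fp s.xsens) then
      ⟨k + 1, V (y (k + 1)), y (k + 1), True⟩
    else
      ⟨s.iref, s.Vref, fp s.xsens, False⟩

/-- The set `𝒯ᵃ` of transmission times produced by the trigger mechanism on the samples `y`. -/
def transmissionTimes {n m : ℕ} (f : Vec n → Vec m → Vec n) (κ : Vec n → Vec m)
    (fp : Vec n → Vec n) (V : Vec n → ℝ) (γ : ℝ → ℝ) (c σ h : ℝ) (ν : ℕ) (y : ℕ → Vec n) :
    Set ℝ :=
  {t | ∃ k : ℕ, t = k * h ∧ (triggerRun f κ fp V γ c σ h ν y k).transmit}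

/-- `ξ = (x, x̂)` is a solution on `[0, ∞)` of the discontinuous dynamical system with sampling
period `h` and transmission times `Ta`, started at `(x₀, x₀)`. -/
structure IsDDSSolution {n m : ℕ} (f : Vec n → Vec m → Vec n) (κ : Vec n → Vec m)
    (fp : Vec n → Vec n) (h : ℝ) (Ta : Set ℝ) (x₀ : Vec n) (ξ : ℝ → PairState n) : Prop where
  init : ξ 0 = pair x₀ x₀
  flow_state : ∀ k : ℕ, ∀ t ∈ Ico ((k : ℝ) * h) ((k + 1 : ℝ) * h),
    HasDerivWithinAt (fun s => (ξ s).fst) (f (ξ t).fst (κ (ξ t).snd))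
      (Ico ((k : ℝ) * h) ((k + 1 : ℝ) * h)) t
  flow_prediction : ∀ k : ℕ, ∀ t ∈ Ico ((k : ℝ) * h) ((k + 1 : ℝ) * h),
    HasDerivWithinAt (fun s => (ξ s).snd) 0 (Ico ((k : ℝ) * h) ((k + 1 : ℝ) * h)) t
  state_leftLim : ∀ k : ℕ, Tendsto (fun s => (ξ s).fst) (𝓝[<] ((k + 1 : ℝ) * h))
    (𝓝 (ξ ((k + 1 : ℝ) * h)).fst)
  predict : ∀ k : ℕ, (k + 1 : ℝ) * h ∉ Ta →
    (ξ ((k + 1 : ℝ) * h)).snd = fp (ξ ((k : ℝ) * h)).snd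
  receive : ∀ k : ℕ, (k + 1 : ℝ) * h ∈ Ta →
    (ξ ((k + 1 : ℝ) * h)).snd = (ξ ((k + 1 : ℝ) * h)).fst

/-- `ξ` is a trajectory of the closed loop: the discontinuous dynamical system whose transmission
times are those that the trigger mechanism selects from the samples `x(kh)` of `ξ` itself. -/
def IsClosedLoop {n m : ℕ} (f : Vec n → Vec m → Vec n) (κ : Vec n → Vec m) (fp : Vec n → Vec n)
    (V : Vec n → ℝ) (γ : ℝ → ℝ) (c σ h : ℝ) (ν : ℕ) (x₀ : Vec n) (ξ : ℝ → PairState n) : Prop :=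
  IsDDSSolution f κ fp h
    (transmissionTimes f κ fp V γ c σ h ν (fun k : ℕ => (ξ ((k : ℝ) * h)).fst)) x₀ ξ

/-- The origin is locally asymptotically stable with region of attraction `R` (containing a
neighbourhood of the origin) for the system whose trajectories from `(x₀, x₀)` are the `ξ` with
`Sol x₀ ξ`; trajectories from `R` exist for all times. -/
structure IsLocallyAsymptoticallyStable {n : ℕ} (Sol : Vec n → (ℝ → PairState n) → Prop)
    (R : Set (Vec n)) : Prop where
  mem_nhds : R ∈ 𝓝 (0 : Vec n)
  exists_solution : ∀ x₀ ∈ R, ∃ ξ, Sol x₀ ξ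
  stable : ∀ ε > 0, ∃ δ > 0, ∀ x₀ ξ, Sol x₀ ξ → ‖pair x₀ x₀‖ ≤ δ → ∀ t, 0 ≤ t → ‖ξ t‖ ≤ ε
  attractive : ∀ x₀ ∈ R, ∀ ξ, Sol x₀ ξ → Tendsto ξ atTop (𝓝 0)

end PETC

end

/-! Everything rests on one estimate per sampling period. Under a constant input u = κ(x̂) with x̂
in 𝒳_c, the plant is L₁-Lipschitz on 𝒳_c, so Gronwall bounds its distance from the sample y after
time t by √e·t·‖f(y,u)‖. Lipschitz continuity of V' turns this into a bound on the derivative of V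
with an error of order √t, and integration gives V ≤ V(y) + λ_t (`le_sampleBound`). The estimate
needs the trajectory to stay in 𝒳_c; a continuation argument supplies this as long as the bound
itself remains below c (`mem_levelSet_of_isSafeSample`).

Two facts keep V below a line descending from the last reference value. Right after a transmission
x̂ = y, and the growth condition with the limit on h preserves the fraction σ of the nominal decay
(`sampleBound_self_le`). Otherwise the trigger test controls the end of the coming period, the
preceding period controls its beginning, and convexity of t ↦ λ_t covers what lies between
(`sampleBound_sub_le`). Induction over the samples gives V ≤ V^ref − (t − i^ref h) σ γ(V^ref)
(`TriggerInvariant`, `trajectory_bound`).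

Some transmission occurs in every ν + 1 consecutive periods, so V^ref decreases to 0. Hence x → 0,
and so does x̂, which is at most ν iterates of f_p applied to a small sample. The descending lines
stay below S because γ(S) shrinks as S decreases (`affine_le`). -/

namespace PETC

open Metric
open scoped NNReal

/-! ### General facts -/

/-- A property of points of `[0, h]` that is closed from the left and open to the right holds on
`[0, h]` once it holds at `0`. -/
theorem forall_Icc_of_continuation {P : ℝ → Prop} {h : ℝ} (zero : P 0)
    (closed : ∀ t ∈ Ioc 0 h, (∀ s ∈ Ico 0 t, P s) → P t)
    (step : ∀ t ∈ Ico 0 h, (∀ s ∈ Icc 0 t, P s) → ∀ᶠ s in 𝓝[>] t, P s) :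
    ∀ t ∈ Icc 0 h, P t := by
  by_contra! hbad
  obtain ⟨b, hb, hPb⟩ := hbad
  set bad : Set ℝ := {t | t ∈ Icc 0 h ∧ ¬ P t} with hbad_def
  have hne : bad.Nonempty := ⟨b, hb, hPb⟩
  have hbdd : BddBelow bad := ⟨0, fun t ht => ht.1.1⟩
  -- At the first bad time τ, `closed` still gives P τ, and `step` then carries P beyond τ, against
  -- τ being the infimum.
  set τ := sInf bad with hτ
  have hτ0 : 0 ≤ τ := le_csInf hne fun t ht => ht.1.1
  have hτb : τ ≤ b := csInf_le hbdd ⟨hb, hPb⟩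
  have hbelow : ∀ s ∈ Ico 0 τ, P s := by
    intro s hs
    by_contra hP
    exact absurd (csInf_le hbdd (show s ∈ bad from ⟨⟨hs.1, by linarith [hs.2, hb.2]⟩, hP⟩))
      (not_le.2 hs.2)
  have hPτ : P τ := by
    rcases hτ0.eq_or_lt with h0 | h0
    · rw [← h0]; exact zero
    · exact closed τ ⟨h0, hτb.trans hb.2⟩ hbelow
  have hτltb : τ < b := lt_of_le_of_ne hτb fun e => hPb (e ▸ hPτ)
  have hall : ∀ s ∈ Icc 0 τ, P s := fun s hs =>
    hs.2.eq_or_lt.elim (fun e => e ▸ hPτ) fun hlt => hbelow s ⟨hs.1, hlt⟩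
  have hev := step τ ⟨hτ0, hτltb.trans_le hb.2⟩ hall
  obtain ⟨u, hu, hPu⟩ := (mem_nhdsGT_iff_exists_Ioo_subset).1 hev
  obtain ⟨t, ht, htu⟩ := exists_lt_of_csInf_lt hne (show sInf bad < u from hu)
  have hτt : τ ≤ t := csInf_le hbdd ht
  rcases hτt.eq_or_lt with e | hlt
  · exact ht.2 (e ▸ hPτ)
  · exact ht.2 (hPu ⟨hlt, htu⟩)

theorem gronwallBound_zero_le {K ε x : ℝ} (hK : 0 ≤ K) (hε : 0 ≤ ε) :
    gronwallBound 0 K ε x ≤ ε * x * Real.exp (K * x) := by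
  rcases hK.eq_or_lt with rfl | hK
  · simp [gronwallBound_K0]
  · rw [gronwallBound_of_K_ne_0 hK.ne']
    -- This is 1 - z ≤ exp (-z) at z = K x, multiplied by exp z.
    have h1 : Real.exp (K * x) - 1 ≤ K * x * Real.exp (K * x) := by
      have h2 := Real.add_one_le_exp (-(K * x))
      have h3 : Real.exp (-(K * x)) * Real.exp (K * x) = 1 := by
        rw [← Real.exp_add]; simp
      nlinarith [Real.exp_pos (K * x)]
    calc 0 * Real.exp (K * x) + ε / K * (Real.exp (K * x) - 1)
        ≤ ε / K * (K * x * Real.exp (K * x)) := by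
          rw [zero_mul, zero_add]; gcongr
      _ = ε * x * Real.exp (K * x) := by field_simp

theorem lipschitzWith_clamp (B : ℝ) : LipschitzWith 1 fun r : ℝ => max (-B) (min B r) :=
  (LipschitzWith.id.const_min B).const_max (-B)

/-- A bounded Lipschitz map into a Euclidean space extends to a bounded Lipschitz map. -/
theorem exists_bounded_lipschitz_extension {n : ℕ} {D : Set (Vec n)} {g : Vec n → Vec n}
    {K : ℝ≥0} (hg : LipschitzOnWith K g D) {B : ℝ} (hB : ∀ x ∈ D, ‖g x‖ ≤ B) :
    ∃ (G : Vec n → Vec n) (K' B' : ℝ≥0),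
      LipschitzWith K' G ∧ (∀ x, ‖G x‖ ≤ B') ∧ EqOn G g D := by
  have hcoord : ∀ i : Fin n, ∃ gi : Vec n → ℝ, LipschitzWith K gi ∧
      EqOn (fun x => g x i) gi D := by
    intro i
    refine LipschitzOnWith.extend_real (LipschitzOnWith.of_dist_le_mul fun x hx y hy => ?_)
    refine le_trans ?_ (hg.dist_le_mul x hx y hy)
    rw [Real.dist_eq, dist_eq_norm]
    exact PiLp.norm_apply_le (g x - g y) i
  choose gi hgi heq using hcoord
  -- Clamping each extended coordinate makes the map bounded and changes nothing on D. The absolute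
  -- value covers a negative B, possible when D is empty.
  set clampMap : Vec n → (Fin n → ℝ) := fun x i => max (-|B|) (min |B| (gi i x)) with hc
  have hcl : LipschitzWith K clampMap := by
    refine LipschitzWith.of_dist_le_mul fun x y => ?_
    refine (dist_pi_le_iff (by positivity)).2 fun i => ?_
    simpa using ((lipschitzWith_clamp |B|).comp (hgi i)).dist_le_mul x y
  have hbound : ∀ x, ‖clampMap x‖ ≤ |B| := fun x =>
    (pi_norm_le_iff_of_nonneg (abs_nonneg B)).2 fun i => by
      rw [Real.norm_eq_abs, abs_le]
      exact ⟨le_max_left _ _, max_le (by linarith [abs_nonneg B]) (min_le_left _ _)⟩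
  obtain ⟨C, hL⟩ : ∃ C, LipschitzWith C (WithLp.toLp 2 : (Fin n → ℝ) → Vec n) :=
    ⟨_, PiLp.lipschitzWith_toLp 2 (fun _ : Fin n => ℝ)⟩
  refine ⟨fun x => WithLp.toLp 2 (clampMap x), _, C * ⟨|B|, abs_nonneg B⟩, hL.comp hcl,
    fun x => ?_, fun x hx => ?_⟩
  · have h1 := hL.dist_le_mul (clampMap x) 0
    rw [WithLp.toLp_zero, dist_zero_right, dist_zero_right] at h1
    exact h1.trans (mul_le_mul_of_nonneg_left (hbound x) (by positivity))
  · ext i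
    have h1 : |g x i| ≤ |B| :=
      ((PiLp.norm_apply_le (g x) i).trans (hB x hx)).trans (le_abs_self B)
    have h2 : gi i x = g x i := (heq i hx).symm
    simp only [hc, h2]
    rw [min_eq_right (abs_le.1 h1).2, max_eq_right (abs_le.1 h1).1]

/-- Global existence on `[0, h]` for a bounded Lipschitz vector field. -/
theorem exists_solution_of_bounded_lipschitz {n : ℕ} {G : Vec n → Vec n} {K B : ℝ≥0}
    (hG : LipschitzWith K G) (hB : ∀ x, ‖G x‖ ≤ B) {h : ℝ} (h0 : 0 ≤ h) (y : Vec n) :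
    ∃ x : ℝ → Vec n, x 0 = y ∧ ∀ t ∈ Icc 0 h, HasDerivWithinAt x (G (x t)) (Icc 0 h) t := by
  -- A field bounded by B moves a point by at most B h in time h, so a ball of radius B h lets
  -- Picard–Lindelöf cover all of [0, h].
  have hPL : IsPicardLindelof (fun _ : ℝ => G) (tmin := 0) (tmax := h) ⟨0, le_rfl, h0⟩ y
      (B * ⟨h, h0⟩) 0 B K := by
    refine IsPicardLindelof.of_time_independent (fun x _ => hB x) hG.lipschitzOnWith ?_
    simp only [sub_zero, max_eq_left h0, sub_self, NNReal.coe_zero]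
    exact le_rfl
  exact hPL.exists_eq_forall_mem_Icc_hasDerivWithinAt₀

theorem hasDerivWithinAt_Ici_of_Ico {E : Type*} [NormedAddCommGroup E] [NormedSpace ℝ E]
    {x : ℝ → E} {x' : E} {a b t : ℝ} (hx : HasDerivWithinAt x x' (Ico a b) t)
    (ht : t ∈ Ico a b) : HasDerivWithinAt x x' (Ici t) t :=
  hx.mono_of_mem_nhdsWithin <|
    mem_of_superset (Ico_mem_nhdsGE ht.2) fun _ hs => ⟨ht.1.trans hs.1, hs.2⟩

/-! ### The sampled-data system -/

/-- The standing assumptions on the plant, the Lyapunov function and the sampling period. -/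
structure Admissible {n m : ℕ} (f : Vec n → Vec m → Vec n) (κ : Vec n → Vec m) (V : Vec n → ℝ)
    (α₁ α₂ γ : ℝ → ℝ) (M : Vec n → ℝ) (c σ h : ℝ) : Prop where
  c_pos : 0 < c
  lyap : LyapunovAssumption f κ V α₁ α₂ γ c
  bdd₁ : BddAbove (quotients₁ f κ V c)
  bdd₂ : BddAbove (quotients₂ V c)
  growth : GrowthAssumption f κ V M c
  σ_mem : σ ∈ Ioo (0 : ℝ) 1
  h_pos : 0 < h
  h_le : h ≤ hMASP f κ V M c σ

/-- The bound on `V` a time `t` after the sample `y`, under the constant input `u`. -/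
noncomputable def sampleBound {n m : ℕ} (f : Vec n → Vec m → Vec n) (κ : Vec n → Vec m) (V : Vec n → ℝ)
    (c : ℝ) (y : Vec n) (u : Vec m) (t : ℝ) : ℝ :=
  V y + lam f κ V c t y u

/-! ### Estimates along one sampling period -/

section

variable {n m : ℕ} {f : Vec n → Vec m → Vec n} {κ : Vec n → Vec m} {V : Vec n → ℝ}
  {α₁ α₂ γ : ℝ → ℝ} {M : Vec n → ℝ} {c σ h : ℝ}

theorem L₁_nonneg : 0 ≤ L₁ f κ V c := by
  refine Real.sSup_nonneg ?_
  rintro r ⟨x₁, _, x₂, _, x₃, _, _, rfl⟩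
  positivity

theorem L₂_nonneg : 0 ≤ L₂ V c := by
  refine Real.sSup_nonneg ?_
  rintro r ⟨x₁, _, x₂, _, _, rfl⟩
  positivity

theorem mu_nonneg : 0 ≤ mu f κ V c :=
  mul_nonneg (Real.sqrt_nonneg _) (L₁_nonneg.trans (le_max_left _ _))

theorem LyapunovAssumption.nonneg (H : LyapunovAssumption f κ V α₁ α₂ γ c) (x : Vec n) :
    0 ≤ V x := by
  by_cases hx : x = 0
  · rw [hx, H.map_zero]
  · exact (H.pos x hx).le

theorem LyapunovAssumption.isClosed_levelSet (H : LyapunovAssumption f κ V α₁ α₂ γ c) :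
    IsClosed (levelSet V c) :=
  isClosed_le H.continuous continuous_const

theorem IsClassK.nonneg {α : ℝ → ℝ} (hα : IsClassK α) {r : ℝ} (hr : 0 ≤ r) : 0 ≤ α r := by
  rw [← hα.map_zero]
  exact hα.strictMonoOn.monotoneOn (mem_Ici.2 le_rfl) (mem_Ici.2 hr) hr

theorem IsClassK.pos {α : ℝ → ℝ} (hα : IsClassK α) {r : ℝ} (hr : 0 < r) : 0 < α r := by
  rw [← hα.map_zero]
  exact hα.strictMonoOn (mem_Ici.2 le_rfl) (mem_Ici.2 hr.le) hr

namespace Admissible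

variable (A : Admissible f κ V α₁ α₂ γ M c σ h)

include A

theorem norm_sub_le {x₁ x₂ x₃ : Vec n} (h₁ : x₁ ∈ levelSet V c) (h₂ : x₂ ∈ levelSet V c)
    (h₃ : x₃ ∈ levelSet V c) : ‖f x₁ (κ x₃) - f x₂ (κ x₃)‖ ≤ L₁ f κ V c * ‖x₁ - x₂‖ := by
  by_cases e : x₁ = x₂
  · simp [e]
  · rw [← div_le_iff₀ (norm_pos_iff.2 (sub_ne_zero.2 e))]
    exact le_csSup A.bdd₁ ⟨x₁, h₁, x₂, h₂, x₃, h₃, e, rfl⟩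

theorem norm_fderiv_sub_le {x₁ x₂ : Vec n} (h₁ : x₁ ∈ levelSet V c) (h₂ : x₂ ∈ levelSet V c) :
    ‖fderiv ℝ V x₁ - fderiv ℝ V x₂‖ ≤ L₂ V c * ‖x₁ - x₂‖ := by
  by_cases e : x₁ = x₂
  · simp [e]
  · rw [← div_le_iff₀ (norm_pos_iff.2 (sub_ne_zero.2 e))]
    exact le_csSup A.bdd₂ ⟨x₁, h₁, x₂, h₂, e, rfl⟩

theorem h_mul_le : h * (1 + 2 * L₁ f κ V c) ≤ 1 := by
  have h1 := A.h_le.trans (min_le_right _ _)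
  have h2 : 0 < 1 + 2 * L₁ f κ V c := by linarith [L₁_nonneg (f := f) (κ := κ) (V := V) (c := c)]
  rwa [le_inv_comm₀ A.h_pos h2, ← one_div, le_div_iff₀ A.h_pos, mul_comm] at h1

theorem h_le_one : h ≤ 1 := by
  nlinarith [A.h_mul_le, A.h_pos, L₁_nonneg (f := f) (κ := κ) (V := V) (c := c)]

/-- The second entry of the minimum in `hMASP` yields L₁ h ≤ 1/2; this is the origin of every √e. -/
theorem exp_le {t : ℝ} (ht : t ∈ Icc 0 h) :
    Real.exp (L₁ f κ V c * t) ≤ √(Real.exp 1) := by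
  rw [← Real.exp_half]
  refine Real.exp_le_exp.2 ?_
  nlinarith [A.h_mul_le, A.h_pos, ht.1, ht.2, L₁_nonneg (f := f) (κ := κ) (V := V) (c := c)]

/-- Growth of the deviation from the sample along a trajectory in the level set. -/
theorem norm_sub_sample_le {x : ℝ → Vec n} {y x₃ : Vec n} (h₃ : x₃ ∈ levelSet V c) {T : ℝ}
    (hT : T ∈ Icc 0 h) (hx : ContinuousOn x (Icc 0 T)) (x0 : x 0 = y)
    (hmem : ∀ t ∈ Icc 0 T, x t ∈ levelSet V c)
    (hder : ∀ t ∈ Ico 0 T, HasDerivWithinAt x (f (x t) (κ x₃)) (Ici t) t) :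
    ∀ t ∈ Icc 0 T, ‖x t - y‖ ≤ √(Real.exp 1) * t * ‖f y (κ x₃)‖ := by
  intro t ht
  have hy : y ∈ levelSet V c := x0 ▸ hmem 0 ⟨le_rfl, ht.1.trans ht.2⟩
  have hg := norm_le_gronwallBound_of_norm_deriv_right_le (f := fun t => x t - y)
    (f' := fun t => f (x t) (κ x₃)) (δ := 0) (K := L₁ f κ V c) (ε := ‖f y (κ x₃)‖)
    (hx.sub continuousOn_const) (fun t ht => (hder t ht).sub_const y) (by simp [x0])
    (fun t ht => by
      have h1 := A.norm_sub_le (hmem t ⟨ht.1, ht.2.le⟩) hy h₃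
      have h2 := norm_le_norm_sub_add (f (x t) (κ x₃)) (f y (κ x₃))
      linarith) t ht
  rw [sub_zero] at hg
  calc ‖x t - y‖ ≤ ‖f y (κ x₃)‖ * t * Real.exp (L₁ f κ V c * t) :=
        hg.trans (gronwallBound_zero_le L₁_nonneg (norm_nonneg _))
    _ ≤ ‖f y (κ x₃)‖ * t * √(Real.exp 1) := by
        have h1 := A.exp_le ⟨ht.1, ht.2.trans hT.2⟩
        have h2 := ht.1
        gcongr
    _ = _ := by ring

omit A in
-- The factor 2/3 and the exponent 3/2 in `lam` come from integrating the error rate √t.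
theorem hasDerivAt_sampleBound (y : Vec n) (u : Vec m) (t : ℝ) :
    HasDerivAt (sampleBound f κ V c y u)
      (lieDeriv f V y u + √t * mu f κ V c * (‖fderiv ℝ V y‖ * ‖f y u‖ + ‖f y u‖ ^ 2)) t := by
  have h1 : HasDerivAt (fun t : ℝ => t ^ (3 / 2 : ℝ)) (3 / 2 * t ^ (3 / 2 - 1 : ℝ)) t :=
    Real.hasDerivAt_rpow_const (Or.inr (by norm_num))
  have h2 := ((((hasDerivAt_id t).mul_const (lieDeriv f V y u)).add
    (((h1.const_mul (2 / 3 : ℝ)).mul_const (mu f κ V c)).mul_const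
      (‖fderiv ℝ V y‖ * ‖f y u‖ + ‖f y u‖ ^ 2))).const_add (V y))
  refine h2.congr_deriv ?_
  rw [Real.sqrt_eq_rpow, show (3 / 2 - 1 : ℝ) = 1 / 2 by norm_num]
  ring

/-- The Lyapunov derivative along a trajectory in the level set. -/
theorem fderiv_apply_le {x y x₃ : Vec n} (hx : x ∈ levelSet V c) (hy : y ∈ levelSet V c)
    (h₃ : x₃ ∈ levelSet V c) {t : ℝ} (ht : t ∈ Icc 0 h)
    (hxy : ‖x - y‖ ≤ √(Real.exp 1) * t * ‖f y (κ x₃)‖) :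
    fderiv ℝ V x (f x (κ x₃)) ≤ lieDeriv f V y (κ x₃) + √t * mu f κ V c *
      (‖fderiv ℝ V y‖ * ‖f y (κ x₃)‖ + ‖f y (κ x₃)‖ ^ 2) := by
  set u := κ x₃
  set e := √(Real.exp 1) with he
  set a := ‖f y u‖ with ha
  set b := ‖fderiv ℝ V y‖ with hb
  have he0 : 0 ≤ e := Real.sqrt_nonneg _
  have ha0 : 0 ≤ a := norm_nonneg _
  have hb0 : 0 ≤ b := norm_nonneg _
  have hL1 : 0 ≤ L₁ f κ V c := L₁_nonneg
  have hL2 : 0 ≤ L₂ V c := L₂_nonneg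
  have ht1 : t ≤ 1 := ht.2.trans A.h_le_one
  -- Since t ≤ 1, the deviation of order t may be weakened to order √t, the rate used in `lam`.
  have hts : t ≤ √t := Real.le_sqrt_of_sq_le (by nlinarith [ht.1])
  have hd : ‖x - y‖ ≤ e * √t * a :=
    hxy.trans (by gcongr)
  have hd' : ‖x - y‖ ≤ e * a := hxy.trans (by
    have h1 : e * t ≤ e * 1 := by gcongr
    rw [mul_one] at h1; gcongr)
  have hf1 : ‖f x u - f y u‖ ≤ L₁ f κ V c * ‖x - y‖ := A.norm_sub_le hx hy h₃
  have hf2 : ‖f x u‖ ≤ (1 + L₁ f κ V c * e) * a := by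
    have h1 := norm_le_norm_sub_add (f x u) (f y u)
    have h2 : L₁ f κ V c * ‖x - y‖ ≤ L₁ f κ V c * (e * a) := by gcongr
    linarith
  -- The first summand produces the ‖f‖² term and the second the ‖V'‖‖f‖ term; their constants are
  -- the two entries of the maximum in `mu`.
  have hsplit : fderiv ℝ V x (f x u) - lieDeriv f V y u =
      (fderiv ℝ V x - fderiv ℝ V y) (f x u) + fderiv ℝ V y (f x u - f y u) := by
    simp [lieDeriv]
  have h1 : (fderiv ℝ V x - fderiv ℝ V y) (f x u) ≤
      L₂ V c * (e * √t * a) * ((1 + L₁ f κ V c * e) * a) := by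
    refine (Real.le_norm_self _).trans ((ContinuousLinearMap.le_opNorm _ _).trans ?_)
    refine mul_le_mul ((A.norm_fderiv_sub_le hx hy).trans (by gcongr)) hf2 (norm_nonneg _)
      (by positivity)
  have h2 : fderiv ℝ V y (f x u - f y u) ≤ b * (L₁ f κ V c * (e * √t * a)) := by
    refine (Real.le_norm_self _).trans ((ContinuousLinearMap.le_opNorm _ _).trans ?_)
    refine mul_le_mul_of_nonneg_left (hf1.trans (by gcongr)) hb0
  have hmu1 : e * L₁ f κ V c ≤ mu f κ V c := mul_le_mul_of_nonneg_left (le_max_left _ _) he0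
  have hmu2 : e * (L₂ V c * (1 + L₁ f κ V c * e)) ≤ mu f κ V c :=
    mul_le_mul_of_nonneg_left (le_max_right _ _) he0
  have h3 : e * L₁ f κ V c * (√t * (b * a)) ≤ mu f κ V c * (√t * (b * a)) := by gcongr
  have h4 : e * (L₂ V c * (1 + L₁ f κ V c * e)) * (√t * a ^ 2) ≤ mu f κ V c * (√t * a ^ 2) := by
    gcongr
  linear_combination h1 + h2 + h3 + h4 + hsplit

/-- The bound on `V` along a trajectory in the level set. -/
theorem le_sampleBound {x : ℝ → Vec n} {y x₃ : Vec n} (h₃ : x₃ ∈ levelSet V c) {T : ℝ}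
    (hT : T ∈ Icc 0 h) (hx : ContinuousOn x (Icc 0 T)) (x0 : x 0 = y)
    (hmem : ∀ t ∈ Icc 0 T, x t ∈ levelSet V c)
    (hder : ∀ t ∈ Ico 0 T, HasDerivWithinAt x (f (x t) (κ x₃)) (Ici t) t) :
    V (x T) ≤ sampleBound f κ V c y (κ x₃) T := by
  have hy : y ∈ levelSet V c := x0 ▸ hmem 0 ⟨le_rfl, hT.1⟩
  refine image_le_of_deriv_right_le_deriv_boundary (f := fun t => V (x t))
    (f' := fun t => fderiv ℝ V (x t) (f (x t) (κ x₃))) (A.lyap.continuous.comp_continuousOn hx)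
    (fun t ht => ?_) (B := sampleBound f κ V c y (κ x₃)) ?_
    (fun t _ => (hasDerivAt_sampleBound y (κ x₃) t).continuousAt.continuousWithinAt)
    (fun t _ => (hasDerivAt_sampleBound y (κ x₃) t).hasDerivWithinAt)
    (fun t ht => ?_) ⟨hT.1, le_rfl⟩
  · exact (A.lyap.differentiableAt _ (hmem t ⟨ht.1, ht.2.le⟩)).hasFDerivAt.comp_hasDerivWithinAt t
      (hder t ht)
  · simp [sampleBound, lam, x0]
  · exact A.fderiv_apply_le (hmem t ⟨ht.1, ht.2.le⟩) hy h₃ ⟨ht.1, ht.2.le.trans hT.2⟩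
      (A.norm_sub_sample_le h₃ hT hx x0 hmem hder t ⟨ht.1, ht.2.le⟩)

end Admissible

end

/-! ### Invariance of the level set, local existence, and decay after a transmission -/

theorem rpow_three_halves {t : ℝ} (ht : 0 ≤ t) : t ^ (3 / 2 : ℝ) = t * √t := by
  rw [Real.sqrt_eq_rpow, ← Real.rpow_one_add' ht (by norm_num)]
  norm_num

theorem eventually_lt_of_hasDerivWithinAt_neg {g : ℝ → ℝ} {g' t : ℝ}
    (hg : HasDerivWithinAt g g' (Ici t) t) (hneg : g' < 0) : ∀ᶠ s in 𝓝[>] t, g s < g t := by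
  have h1 := (hasDerivWithinAt_iff_tendsto_slope' self_notMem_Ioi).1 (hg.mono Ioi_subset_Ici_self)
  filter_upwards [h1.eventually (gt_mem_nhds hneg), self_mem_nhdsWithin] with s hs hst
  rw [slope_def_field, div_neg_iff] at hs
  have h2 : 0 < s - t := sub_pos.2 hst
  rcases hs with ⟨_, h3⟩ | ⟨h3, _⟩ <;> linarith

/-- A sample `y`, with the input computed from `xs`, from which the plant cannot leave the level
set within one sampling period. -/
structure IsSafeSample {n m : ℕ} (f : Vec n → Vec m → Vec n) (κ : Vec n → Vec m) (V : Vec n → ℝ)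
    (c h : ℝ) (y xs : Vec n) : Prop where
  sample_mem : y ∈ levelSet V c
  sens_mem : xs ∈ levelSet V c
  bound_lt : ∀ t ∈ Ioc 0 h, sampleBound f κ V c y (κ xs) t < c
  inward : V y < c ∨ lieDeriv f V y (κ xs) < 0

section

variable {n m : ℕ} {f : Vec n → Vec m → Vec n} {κ : Vec n → Vec m} {V : Vec n → ℝ}
  {α₁ α₂ γ : ℝ → ℝ} {M : Vec n → ℝ} {c σ h : ℝ}

/-- The convex function t ↦ λ_t lies below its chord over [0, h]; this extends the trigger test from
the end of a period to all of it. -/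
theorem sampleBound_sub_le {t : ℝ} (ht : t ∈ Icc 0 h) (y : Vec n) (u : Vec m) :
    h * (sampleBound f κ V c y u t - V y) ≤ t * (sampleBound f κ V c y u h - V y) := by
  have h0 : 0 ≤ h := ht.1.trans ht.2
  have h1 : √t ≤ √h := Real.sqrt_le_sqrt ht.2
  have h2 : 0 ≤ mu f κ V c * (‖fderiv ℝ V y‖ * ‖f y u‖ + ‖f y u‖ ^ 2) :=
    mul_nonneg mu_nonneg (by positivity)
  simp only [sampleBound, lam, rpow_three_halves ht.1, rpow_three_halves h0]
  nlinarith [mul_le_mul_of_nonneg_left h1 (mul_nonneg (mul_nonneg ht.1 h0) h2)]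

namespace Admissible

variable (A : Admissible f κ V α₁ α₂ γ M c σ h)

include A

/-- A trajectory starting at a safe sample stays in the level set, and near the sample, during the
sampling period. -/
theorem mem_levelSet_of_isSafeSample {y xs : Vec n} (S : IsSafeSample f κ V c h y xs) {R : ℝ}
    (hR : √(Real.exp 1) * h * ‖f y (κ xs)‖ < R) {x : ℝ → Vec n}
    (hx : ContinuousOn x (Icc 0 h)) (x0 : x 0 = y)
    (hder : ∀ t ∈ Ico 0 h, x t ∈ levelSet V c ∩ closedBall y R →
      HasDerivWithinAt x (f (x t) (κ xs)) (Ici t) t) :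
    ∀ t ∈ Icc 0 h, x t ∈ levelSet V c ∩ closedBall y R := by
  have hR0 : 0 < R := lt_of_le_of_lt
    (mul_nonneg (mul_nonneg (Real.sqrt_nonneg _) A.h_pos.le) (norm_nonneg _)) hR
  refine forall_Icc_of_continuation ?_ ?_ ?_
  · rw [x0]
    exact ⟨S.sample_mem, mem_closedBall_self hR0.le⟩
  · intro t ht hs
    have : (𝓝[Ico 0 t] t).NeBot := right_nhdsWithin_Ico_neBot ht.1
    exact (A.lyap.isClosed_levelSet.inter isClosed_closedBall).mem_of_tendsto
      ((hx t ⟨ht.1.le, ht.2⟩).mono fun s hs => ⟨hs.1, hs.2.le.trans ht.2⟩)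
      (mem_of_superset self_mem_nhdsWithin hs)
  · intro t ht hs
    have hxt : Tendsto x (𝓝[>] t) (𝓝 (x t)) :=
      (hx t ⟨ht.1, ht.2.le⟩).mono_left <| nhdsWithin_le_iff.2 <|
        mem_of_superset (Ioo_mem_nhdsGT ht.2) fun s hs => ⟨ht.1.trans hs.1.le, hs.2.le⟩
    -- The equation is available only inside the level set and the ball, so that solutions of an
    -- extended field are admitted too.
    have hder' : ∀ s ∈ Ico 0 t, HasDerivWithinAt x (f (x s) (κ xs)) (Ici s) s := fun s hst =>
      hder s ⟨hst.1, hst.2.trans ht.2⟩ (hs s ⟨hst.1, hst.2.le⟩)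
    have hxT : ContinuousOn x (Icc 0 t) := hx.mono (Icc_subset_Icc_right ht.2.le)
    have hball : ∀ᶠ s in 𝓝[>] t, x s ∈ closedBall y R := by
      have h1 := A.norm_sub_sample_le S.sens_mem ⟨ht.1, ht.2.le⟩ hxT x0 (fun s h => (hs s h).1)
        hder' t ⟨ht.1, le_rfl⟩
      have h2 : x t ∈ ball y R := by
        rw [mem_ball_iff_norm]
        refine lt_of_le_of_lt (h1.trans ?_) hR
        have := ht.2.le
        gcongr
      exact (hxt.eventually (isOpen_ball.mem_nhds h2)).mono fun s hs => ball_subset_closedBall hs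
    have hlev_of_lt : V (x t) < c → ∀ᶠ s in 𝓝[>] t, x s ∈ levelSet V c := fun hlt =>
      (((A.lyap.continuous.tendsto (x t)).comp hxt).eventually (gt_mem_nhds hlt)).mono
        fun s hs => hs.le
    -- For t > 0 the bound is strictly below c. At t = 0 it equals V y, possibly c, and then the
    -- sign of the Lie derivative is needed.
    have hlev : ∀ᶠ s in 𝓝[>] t, x s ∈ levelSet V c := by
      rcases ht.1.eq_or_lt with rfl | htpos
      · rcases S.inward with hlt | hneg
        · exact hlev_of_lt (x0 ▸ hlt)
        · have h1 := (A.lyap.differentiableAt (x 0) (x0 ▸ S.sample_mem)).hasFDerivAt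
            |>.comp_hasDerivWithinAt 0 (hder 0 ht (hs 0 ⟨le_rfl, le_rfl⟩))
          have h2 : fderiv ℝ V (x 0) (f (x 0) (κ xs)) < 0 := by rw [x0]; exact hneg
          have h3 : V (x 0) ≤ c := x0 ▸ S.sample_mem
          exact (eventually_lt_of_hasDerivWithinAt_neg h1 h2).mono fun s hs =>
            (lt_of_lt_of_le hs h3).le
      · exact hlev_of_lt <| lt_of_le_of_lt
          (A.le_sampleBound S.sens_mem ⟨ht.1, ht.2.le⟩ hxT x0 (fun s h => (hs s h).1) hder')
          (S.bound_lt t ⟨htpos, ht.2.le⟩)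
    filter_upwards [hlev, hball] with s h1 h2 using ⟨h1, h2⟩

/-- A trajectory starting at a safe sample stays in the level set and obeys the bound on `V`. -/
theorem mem_levelSet_and_le_sampleBound {y xs : Vec n} (S : IsSafeSample f κ V c h y xs)
    {x : ℝ → Vec n} (hx : ContinuousOn x (Icc 0 h)) (x0 : x 0 = y)
    (hder : ∀ t ∈ Ico 0 h, HasDerivWithinAt x (f (x t) (κ xs)) (Ici t) t) :
    ∀ t ∈ Icc 0 h, x t ∈ levelSet V c ∧ V (x t) ≤ sampleBound f κ V c y (κ xs) t := by
  have hmem := A.mem_levelSet_of_isSafeSample S (lt_add_one _) hx x0 fun t ht _ => hder t ht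
  intro t ht
  refine ⟨(hmem t ht).1, A.le_sampleBound S.sens_mem ht (hx.mono (Icc_subset_Icc_right ht.2)) x0
    (fun s hs => (hmem s ⟨hs.1, hs.2.trans ht.2⟩).1) fun s hs => hder s ⟨hs.1, hs.2.trans_le ht.2⟩⟩

/-- The field is Lipschitz only on the level set, which is not assumed bounded. Its restriction to a
ball around y is bounded and extends globally; the solution for the extension never leaves the set
where both fields agree. -/
theorem exists_flow {y xs : Vec n} (S : IsSafeSample f κ V c h y xs) :
    ∃ x : ℝ → Vec n, x 0 = y ∧
      ∀ t ∈ Icc 0 h, HasDerivWithinAt x (f (x t) (κ xs)) (Icc 0 h) t := by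
  set R := √(Real.exp 1) * h * ‖f y (κ xs)‖ + 1 with hR
  have hlip : LipschitzOnWith ⟨L₁ f κ V c, L₁_nonneg⟩ (fun x => f x (κ xs))
      (levelSet V c ∩ closedBall y R) := by
    refine LipschitzOnWith.of_dist_le_mul fun x hx z hz => ?_
    rw [dist_eq_norm, dist_eq_norm]
    exact A.norm_sub_le hx.1 hz.1 S.sens_mem
  have hbd : ∀ x ∈ levelSet V c ∩ closedBall y R,
      ‖f x (κ xs)‖ ≤ L₁ f κ V c * R + ‖f y (κ xs)‖ := by
    intro x hx
    have h1 := A.norm_sub_le hx.1 S.sample_mem S.sens_mem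
    have h2 := norm_le_norm_sub_add (f x (κ xs)) (f y (κ xs))
    have h3 := mul_le_mul_of_nonneg_left (mem_closedBall_iff_norm.1 hx.2)
      (L₁_nonneg (f := f) (κ := κ) (V := V) (c := c))
    linarith
  obtain ⟨G, K, B, hG, hB, heq⟩ := exists_bounded_lipschitz_extension hlip hbd
  obtain ⟨x, x0, hx⟩ := exists_solution_of_bounded_lipschitz hG hB A.h_pos.le y
  have hmem := A.mem_levelSet_of_isSafeSample S (lt_add_one _)
    (fun t ht => (hx t ht).continuousWithinAt) x0 fun t ht hxt => by
      have e : G (x t) = f (x t) (κ xs) := heq hxt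
      rw [← e]
      exact hasDerivWithinAt_Ici_of_Ico ((hx t ⟨ht.1, ht.2.le⟩).mono Ico_subset_Icc_self) ht
  refine ⟨x, x0, fun t ht => ?_⟩
  have e : G (x t) = f (x t) (κ xs) := heq (hmem t ht)
  exact e ▸ hx t ht

theorem M_le {x : Vec n} (hx : x ∈ levelSet V c) : M x ≤ sSup (M '' levelSet V c) :=
  le_csSup A.growth.bddAbove ⟨x, hx, rfl⟩

theorem sSup_M_nonneg : 0 ≤ sSup (M '' levelSet V c) := by
  rw [← A.growth.map_zero]
  exact A.M_le (show V 0 ≤ c by rw [A.lyap.map_zero]; exact A.c_pos.le)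

/-- The first entry of the minimum in `hMASP`, solved for √h. -/
theorem sqrt_h_mul_le :
    2 / 3 * √h * (mu f κ V c * sSup (M '' levelSet V c)) ≤ 1 - σ := by
  have hσ := A.σ_mem.2
  have h0 : 0 ≤ mu f κ V c * sSup (M '' levelSet V c) := mul_nonneg mu_nonneg A.sSup_M_nonneg
  -- With a zero denominator the quotient in `hMASP` is 0 by convention and gives no such estimate,
  -- but then the claim is just σ ≤ 1.
  rcases h0.eq_or_lt with e | hpos
  · rw [← e]; linarith
  · have h1 := A.h_le.trans (min_le_left _ _)
    have h2 : √h ≤ 3 * (1 - σ) / (2 * mu f κ V c * sSup (M '' levelSet V c)) := by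
      rw [Real.sqrt_le_iff]
      exact ⟨div_nonneg (by linarith) (by linarith), h1⟩
    rw [le_div_iff₀ (by linarith)] at h2
    linarith

/-- Right after a transmission `V` decreases at rate `σ γ(V y)`. -/
theorem sampleBound_self_le {y : Vec n} (hy : y ∈ levelSet V c) {t : ℝ} (ht : t ∈ Icc 0 h) :
    sampleBound f κ V c y (κ y) t ≤ V y - t * σ * γ (V y) := by
  have hdec : lieDeriv f V y (κ y) ≤ -γ (V y) := A.lyap.decrease y hy
  have hγ := A.lyap.classK_γ.nonneg (A.lyap.nonneg y)
  have hgr := A.growth.growth y hy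
  rw [abs_of_nonpos (by linarith)] at hgr
  set l := lieDeriv f V y (κ y)
  set a := ‖fderiv ℝ V y‖ * ‖f y (κ y)‖ + ‖f y (κ y)‖ ^ 2
  set Mm := sSup (M '' levelSet V c)
  have hmu : 0 ≤ mu f κ V c := mu_nonneg
  have hM0 := A.sSup_M_nonneg
  have ha : a ≤ Mm * -l := hgr.trans (mul_le_mul_of_nonneg_right (A.M_le hy) (by linarith))
  have hs : √t ≤ √h := Real.sqrt_le_sqrt ht.2
  -- The error term consumes at most the fraction 1 - σ of the decay -l.
  have h1 : 2 / 3 * √t * mu f κ V c * a ≤ (1 - σ) * -l := calc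
    2 / 3 * √t * mu f κ V c * a ≤ 2 / 3 * √h * mu f κ V c * (Mm * -l) := by
        gcongr
    _ = 2 / 3 * √h * (mu f κ V c * Mm) * -l := by ring
    _ ≤ _ := mul_le_mul_of_nonneg_right A.sqrt_h_mul_le (by linarith)
  have h2 : l + 2 / 3 * √t * mu f κ V c * a ≤ -(σ * γ (V y)) := by
    have := mul_le_mul_of_nonneg_left hdec A.σ_mem.1.le
    linarith
  have h3 := mul_le_mul_of_nonneg_left h2 ht.1
  change V y + (t * l + 2 / 3 * t ^ (3 / 2 : ℝ) * mu f κ V c * a) ≤ _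
  rw [rpow_three_halves ht.1]
  linarith

/-- Strict even for W = c, because γ(c) > 0; this keeps V off the boundary of the level set at
positive times. -/
theorem sub_lt_of_pos {W a : ℝ} (hW : W ∈ Icc 0 c) (ha : 0 < a) : W - a * σ * γ W < c := by
  rcases hW.2.eq_or_lt with rfl | hlt
  · have := mul_pos (mul_pos ha A.σ_mem.1) (A.lyap.classK_γ.pos A.c_pos)
    linarith
  · have := mul_nonneg (mul_nonneg ha.le A.σ_mem.1.le) (A.lyap.classK_γ.nonneg hW.1)
    linarith

end Admissible

end

/-! ### The invariant of the trigger mechanism -/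

/-- What the memory `s` of the trigger mechanism guarantees after the sampling instant `kh`. -/
structure TriggerInvariant {n m : ℕ} (f : Vec n → Vec m → Vec n) (κ : Vec n → Vec m)
    (fp : Vec n → Vec n) (V : Vec n → ℝ) (γ : ℝ → ℝ) (c σ h : ℝ) (ν : ℕ) (y : ℕ → Vec n) (k : ℕ)
    (s : TriggerState n) : Prop where
  iref_le : s.iref ≤ k
  le_iref_add : k ≤ s.iref + ν
  Vref_eq : V (y s.iref) = s.Vref
  Vref_le : s.Vref ≤ c
  xsens_eq : s.xsens = fp^[k - s.iref] (y s.iref)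
  xsens_mem : s.xsens ∈ levelSet V c
  sample_mem : y k ∈ levelSet V c
  bound : ∀ t ∈ Icc 0 h, sampleBound f κ V c (y k) (κ s.xsens) t ≤
    s.Vref - (((k : ℝ) - s.iref) * h + t) * σ * γ s.Vref
  inward : V (y k) < c ∨ lieDeriv f V (y k) (κ s.xsens) < 0

section

variable {n m : ℕ} {f : Vec n → Vec m → Vec n} {κ : Vec n → Vec m} {fp : Vec n → Vec n}
  {V : Vec n → ℝ} {α₁ α₂ γ : ℝ → ℝ} {M : Vec n → ℝ} {c σ h : ℝ} {ν : ℕ} {y : ℕ → Vec n} {k : ℕ}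

theorem triggerRun_succ_of_triggers
    (H : triggers f κ V γ c σ h ν (k + 1) (triggerRun f κ fp V γ c σ h ν y k).iref
      (triggerRun f κ fp V γ c σ h ν y k).Vref (y (k + 1))
      (fp (triggerRun f κ fp V γ c σ h ν y k).xsens)) :
    triggerRun f κ fp V γ c σ h ν y (k + 1) = ⟨k + 1, V (y (k + 1)), y (k + 1), True⟩ :=
  if_pos H

theorem triggerRun_succ_of_not_triggers
    (H : ¬ triggers f κ V γ c σ h ν (k + 1) (triggerRun f κ fp V γ c σ h ν y k).iref
      (triggerRun f κ fp V γ c σ h ν y k).Vref (y (k + 1))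
      (fp (triggerRun f κ fp V γ c σ h ν y k).xsens)) :
    triggerRun f κ fp V γ c σ h ν y (k + 1) =
      ⟨(triggerRun f κ fp V γ c σ h ν y k).iref, (triggerRun f κ fp V γ c σ h ν y k).Vref,
        fp (triggerRun f κ fp V γ c σ h ν y k).xsens, False⟩ :=
  if_neg H

namespace Admissible

variable (A : Admissible f κ V α₁ α₂ γ M c σ h)

include A

theorem triggerInvariant_of_transmit (hy : y k ∈ levelSet V c) :
    TriggerInvariant f κ fp V γ c σ h ν y k ⟨k, V (y k), y k, True⟩ where
  iref_le := le_rfl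
  le_iref_add := Nat.le_add_right _ _
  Vref_eq := rfl
  Vref_le := hy
  xsens_eq := by simp
  xsens_mem := hy
  sample_mem := hy
  bound t ht := by simpa using A.sampleBound_self_le hy ht
  inward := by
    rcases (show V (y k) ≤ c from hy).lt_or_eq with h1 | h1
    · exact Or.inl h1
    · have h2 := A.lyap.decrease _ hy
      have h3 := A.lyap.classK_γ.pos A.c_pos
      rw [h1] at h2
      exact Or.inr (by linarith)

theorem triggerInvariant_zero (hy : y 0 ∈ levelSet V c) :
    TriggerInvariant f κ fp V γ c σ h ν y 0 (triggerRun f κ fp V γ c σ h ν y 0) :=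
  A.triggerInvariant_of_transmit hy

omit A in
theorem TriggerInvariant.cast_le {s : TriggerState n}
    (I : TriggerInvariant f κ fp V γ c σ h ν y k s) : (s.iref : ℝ) ≤ k := by
  exact_mod_cast I.iref_le

theorem Vref_mem {s : TriggerState n} (I : TriggerInvariant f κ fp V γ c σ h ν y k s) :
    s.Vref ∈ Icc 0 c :=
  ⟨I.Vref_eq ▸ A.lyap.nonneg _, I.Vref_le⟩

theorem rate_nonneg {s : TriggerState n} (I : TriggerInvariant f κ fp V γ c σ h ν y k s) :
    0 ≤ σ * γ s.Vref :=
  mul_nonneg A.σ_mem.1.le (A.lyap.classK_γ.nonneg (A.Vref_mem I).1)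

theorem isSafeSample {s : TriggerState n} (I : TriggerInvariant f κ fp V γ c σ h ν y k s) :
    IsSafeSample f κ V c h (y k) s.xsens where
  sample_mem := I.sample_mem
  sens_mem := I.xsens_mem
  bound_lt t ht := by
    refine (I.bound t ⟨ht.1.le, ht.2⟩).trans_lt (A.sub_lt_of_pos (A.Vref_mem I) ?_)
    have := mul_nonneg (sub_nonneg.2 (TriggerInvariant.cast_le I)) A.h_pos.le
    linarith [ht.1]
  inward := I.inward

/-- A transmission restarts the invariant. Without one, the three negated trigger conditions bound
the age of the prediction, keep the prediction in the level set, and control V at the end of the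
next period. -/
theorem triggerInvariant_succ
    (I : TriggerInvariant f κ fp V γ c σ h ν y k (triggerRun f κ fp V γ c σ h ν y k))
    (hy : V (y (k + 1)) ≤ sampleBound f κ V c (y k)
      (κ (triggerRun f κ fp V γ c σ h ν y k).xsens) h) :
    TriggerInvariant f κ fp V γ c σ h ν y (k + 1) (triggerRun f κ fp V γ c σ h ν y (k + 1)) := by
  have hVy := hy.trans (I.bound h ⟨A.h_pos.le, le_rfl⟩)
  have hlt : V (y (k + 1)) < c :=
    hy.trans_lt ((A.isSafeSample I).bound_lt h ⟨A.h_pos, le_rfl⟩)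
  by_cases H : triggers f κ V γ c σ h ν (k + 1) (triggerRun f κ fp V γ c σ h ν y k).iref
      (triggerRun f κ fp V γ c σ h ν y k).Vref (y (k + 1))
      (fp (triggerRun f κ fp V γ c σ h ν y k).xsens)
  · rw [triggerRun_succ_of_triggers H]
    exact A.triggerInvariant_of_transmit hlt.le
  · rw [triggerRun_succ_of_not_triggers H]
    set s := triggerRun f κ fp V γ c σ h ν y k
    simp only [triggers, not_or, not_lt, not_le] at H
    obtain ⟨h1, h2, h3⟩ := H
    refine ⟨I.iref_le.trans (Nat.le_succ k), ?_, I.Vref_eq, I.Vref_le, ?_, h2, hlt.le, ?_,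
      Or.inl hlt⟩
    · have : ((k + 1 : ℕ) : ℝ) ≤ ((s.iref + ν : ℕ) : ℝ) := by push_cast at h1 ⊢; linarith
      exact_mod_cast this
    · change fp s.xsens = fp^[k + 1 - s.iref] (y s.iref)
      rw [I.xsens_eq, Nat.succ_sub I.iref_le, Function.iterate_succ_apply']
    · intro t ht
      change sampleBound f κ V c (y (k + 1)) (κ (fp s.xsens)) t ≤
        s.Vref - (((k + 1 : ℕ) - s.iref : ℝ) * h + t) * σ * γ s.Vref
      -- Both endpoint values lie below the same line, the left by the previous period (`hVy`) and
      -- the right by the trigger test (`h5`); weights h - t and t then combine them.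
      have h4 := sampleBound_sub_le (f := f) (κ := κ) (V := V) (c := c) ht (y (k + 1))
        (κ (fp s.xsens))
      set p := sampleBound f κ V c (y (k + 1)) (κ (fp s.xsens)) with hp
      have h5 : p h ≤ s.Vref - (((k + 1 : ℕ) : ℝ) - s.iref + 1) * h * σ * γ s.Vref := h3.le
      have h6 := A.h_pos
      push_cast at h5 hVy ⊢
      rw [← mul_le_mul_iff_right₀ h6]
      have h7 := mul_le_mul_of_nonneg_left h5 ht.1
      have h8 := mul_le_mul_of_nonneg_left hVy (sub_nonneg.2 ht.2)
      linear_combination h4 + h7 + h8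

/-- At a sampling instant the reference is kept, or it is reset to a smaller value. -/
theorem triggerRun_succ_cases
    (I : TriggerInvariant f κ fp V γ c σ h ν y k (triggerRun f κ fp V γ c σ h ν y k))
    (hy : V (y (k + 1)) ≤ sampleBound f κ V c (y k)
      (κ (triggerRun f κ fp V γ c σ h ν y k).xsens) h) :
    ((triggerRun f κ fp V γ c σ h ν y (k + 1)).iref = (triggerRun f κ fp V γ c σ h ν y k).iref ∧
      (triggerRun f κ fp V γ c σ h ν y (k + 1)).Vref = (triggerRun f κ fp V γ c σ h ν y k).Vref) ∨
    (triggerRun f κ fp V γ c σ h ν y (k + 1)).Vref ≤ (triggerRun f κ fp V γ c σ h ν y k).Vref -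
      h * (σ * γ (triggerRun f κ fp V γ c σ h ν y k).Vref) := by
  by_cases H : triggers f κ V γ c σ h ν (k + 1) (triggerRun f κ fp V γ c σ h ν y k).iref
      (triggerRun f κ fp V γ c σ h ν y k).Vref (y (k + 1))
      (fp (triggerRun f κ fp V γ c σ h ν y k).xsens)
  · right
    rw [triggerRun_succ_of_triggers H]
    have h1 := hy.trans (I.bound h ⟨A.h_pos.le, le_rfl⟩)
    have h2 := mul_nonneg (mul_nonneg (sub_nonneg.2 (TriggerInvariant.cast_le I)) A.h_pos.le)
      (A.rate_nonneg I)
    change V (y (k + 1)) ≤ _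
    linarith
  · left
    rw [triggerRun_succ_of_not_triggers H]
    exact ⟨rfl, rfl⟩

end Admissible

/-! ### Decreasing sequences and comparison with S -/

/-- An antitone nonnegative sequence that decreases by `g (u k)` over every `N` steps, with `g`
monotone and positive on `(0, ∞)`, tends to zero. -/
theorem tendsto_zero_of_decrease {u : ℕ → ℝ} {g : ℝ → ℝ} {N : ℕ} (hu : Antitone u)
    (h0 : ∀ k, 0 ≤ u k) (hg : MonotoneOn g (Ici 0)) (hpos : ∀ r, 0 < r → 0 < g r)
    (hdec : ∀ k, u (k + N) ≤ u k - g (u k)) : Tendsto u atTop (𝓝 0) := by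
  have hbdd : BddBelow (range u) := ⟨0, by rintro _ ⟨k, rfl⟩; exact h0 k⟩
  have hlim := tendsto_atTop_ciInf hu hbdd
  set l := ⨅ k, u k
  have hl0 : 0 ≤ l := le_ciInf h0
  rcases hl0.eq_or_lt with e | hl
  · rwa [← e] at hlim
  · exfalso
    -- Since l ≤ u k, monotonicity replaces g (u k) by the constant g l before the limit, so
    -- continuity of g is not needed.
    have h1 : l ≤ l - g l := by
      refine le_of_tendsto_of_tendsto' (hlim.comp (tendsto_add_atTop_nat N))
        (hlim.sub_const (g l)) fun k => (hdec k).trans ?_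
      have := hg (mem_Ici.2 hl0) (mem_Ici.2 (h0 k)) (ciInf_le hbdd k)
      linarith
    linarith [hpos l hl]

theorem IsComparisonSolution.antitoneOn {S : ℝ → ℝ} {S₀ : ℝ}
    (hS : IsComparisonSolution γ σ S₀ S) (hγ : IsClassK γ) (hσ : 0 ≤ σ) : AntitoneOn S (Ici 0) := by
  intro a ha b _ hab
  have hder : ∀ t, 0 ≤ t → HasDerivWithinAt S (-(σ * γ (S t))) (Ici t) t := fun t ht =>
    (hS.hasDeriv t ht).mono (Ici_subset_Ici.2 ht)
  refine image_le_of_deriv_right_le_deriv_boundary (a := a) (b := b) (f := S)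
    (B := fun _ => S a) (B' := fun _ => 0)
    (fun t ht => (hS.hasDeriv t (ha.trans ht.1)).continuousWithinAt.mono fun s hs => ha.trans hs.1)
    (fun t ht => hder t (ha.trans ht.1)) le_rfl continuousOn_const
    (fun t _ => hasDerivWithinAt_const _ _ _) (fun t ht => ?_) ⟨hab, le_rfl⟩
  have := mul_nonneg hσ (hγ.nonneg (hS.nonneg t (ha.trans ht.1)))
  linarith

/-- Comparison of an affine function with a solution of `S' = -σ γ(S)`. -/
theorem IsComparisonSolution.affine_le {S : ℝ → ℝ} {S₀ : ℝ} (hS : IsComparisonSolution γ σ S₀ S)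
    (hγ : IsClassK γ) (hσ : 0 ≤ σ) {W a t : ℝ} (ha : 0 ≤ a) (hat : a ≤ t) (hW0 : 0 ≤ W)
    (hW : W ≤ S a) : W - (t - a) * (σ * γ W) ≤ S t := by
  have hC : 0 ≤ σ * γ W := mul_nonneg hσ (hγ.nonneg hW0)
  have hcont : ContinuousOn S (Icc a t) := fun s hs =>
    (hS.hasDeriv s (ha.trans hs.1)).continuousWithinAt.mono fun r hr => ha.trans hr.1
  rcases le_total W (S t) with h1 | h1
  · have := mul_nonneg (sub_nonneg.2 hat) hC
    linarith
  -- From the time s at which S crosses W onwards, S ≤ W, so S falls no faster than slope -σ γ(W).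
  -- Starting the line at s instead of a only raises it.
  · obtain ⟨s, hs, hsW⟩ := intermediate_value_Icc' hat hcont ⟨h1, hW⟩
    have hs0 : 0 ≤ s := ha.trans hs.1
    have hmono := hS.antitoneOn hγ hσ
    have h2 : W - (t - s) * (σ * γ W) ≤ S t := by
      refine image_le_of_deriv_right_le_deriv_boundary (a := s) (b := t)
        (f := fun r => W - (r - s) * (σ * γ W)) (f' := fun _ => -(1 * (σ * γ W))) (B := S)
        (by fun_prop)
        (fun r _ => ((((hasDerivAt_id r).sub_const s).mul_const _).const_sub W).hasDerivWithinAt)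
        (by simp [hsW]) (hcont.mono (Icc_subset_Icc_left hs.1))
        (fun r hr => (hS.hasDeriv r (hs0.trans hr.1)).mono (Ici_subset_Ici.2 (hs0.trans hr.1)))
        (fun r hr => ?_) ⟨hs.2, le_rfl⟩
      have hr0 : 0 ≤ r := hs0.trans hr.1
      have h3 : γ (S r) ≤ γ W := hγ.strictMonoOn.monotoneOn (mem_Ici.2 (hS.nonneg r hr0))
        (mem_Ici.2 hW0) (hsW ▸ hmono hs0 hr0 hr.1)
      have := mul_le_mul_of_nonneg_left h3 hσ
      linarith
    have := mul_le_mul_of_nonneg_right hs.1 hC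
    linarith

end

/-! ### Bounds along closed-loop trajectories -/

/-- The samples `x(kh)` of a trajectory. -/
def samples {n : ℕ} (h : ℝ) (ξ : ℝ → PairState n) (k : ℕ) : Vec n := (ξ ((k : ℝ) * h)).fst

section

variable {n m : ℕ} {f : Vec n → Vec m → Vec n} {κ : Vec n → Vec m} {fp : Vec n → Vec n}
  {V : Vec n → ℝ} {α₁ α₂ γ : ℝ → ℝ} {M : Vec n → ℝ} {c σ h : ℝ} {ν : ℕ} {x₀ : Vec n}
  {ξ : ℝ → PairState n}

theorem mem_transmissionTimes_iff (hh : 0 < h) {y : ℕ → Vec n} {k : ℕ} :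
    ((k : ℝ) + 1) * h ∈ transmissionTimes f κ fp V γ c σ h ν y ↔
      (triggerRun f κ fp V γ c σ h ν y (k + 1)).transmit := by
  constructor
  · rintro ⟨j, hj, ht⟩
    have h1 : ((k + 1 : ℕ) : ℝ) = j := by
      push_cast
      exact mul_right_cancel₀ hh.ne' hj
    rwa [Nat.cast_inj.1 h1]
  · exact fun ht => ⟨k + 1, by push_cast; rfl, ht⟩

theorem exists_mem_Ico_mul (hh : 0 < h) {t : ℝ} (ht : 0 ≤ t) :
    t ∈ Ico ((⌊t / h⌋₊ : ℝ) * h) ((⌊t / h⌋₊ + 1 : ℝ) * h) :=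
  ⟨(le_div_iff₀ hh).1 (Nat.floor_le (by positivity)),
    (div_lt_iff₀ hh).1 (Nat.lt_floor_add_one _)⟩

theorem floor_div_eq (hh : 0 < h) {k : ℕ} {t : ℝ} (ht : t ∈ Ico ((k : ℝ) * h) ((k + 1 : ℝ) * h)) :
    ⌊t / h⌋₊ = k :=
  (Nat.floor_eq_iff (div_nonneg ((by positivity : (0 : ℝ) ≤ k * h).trans ht.1) hh.le)).2
    ⟨(le_div_iff₀ hh).2 ht.1, (div_lt_iff₀ hh).2 ht.2⟩

namespace IsClosedLoop

variable (C : IsClosedLoop f κ fp V γ c σ h ν x₀ ξ)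

include C

theorem sample_zero : samples h ξ 0 = x₀ := by
  have := C.init
  simp [samples, this, pair]

/-- The controller's prediction and the copy held by the trigger follow the same reset rule; hence
the input tested by the trigger is the one the plant receives. -/
theorem snd_sample (hh : 0 < h) (k : ℕ) :
    (ξ ((k : ℝ) * h)).snd = (triggerRun f κ fp V γ c σ h ν (samples h ξ) k).xsens := by
  induction k with
  | zero =>
    have := C.init
    simp [triggerRun, samples, this, pair]
  | succ k ih =>
    have hTa := mem_transmissionTimes_iff (f := f) (κ := κ) (fp := fp) (V := V) (γ := γ) (c := c)
      (σ := σ) (ν := ν) (y := samples h ξ) (k := k) hh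
    have e : ((k + 1 : ℕ) : ℝ) = k + 1 := by push_cast; rfl
    by_cases H : triggers f κ V γ c σ h ν (k + 1)
        (triggerRun f κ fp V γ c σ h ν (samples h ξ) k).iref
        (triggerRun f κ fp V γ c σ h ν (samples h ξ) k).Vref (samples h ξ (k + 1))
        (fp (triggerRun f κ fp V γ c σ h ν (samples h ξ) k).xsens)
    · rw [triggerRun_succ_of_triggers H] at hTa ⊢
      have := C.receive k (hTa.2 trivial)
      rw [e, this, samples, e]
    · rw [triggerRun_succ_of_not_triggers H] at hTa ⊢
      have := C.predict k fun hmem => hTa.1 hmem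
      rw [e, this, ih]

theorem snd_eq (hh : 0 < h) {k : ℕ} {t : ℝ} (ht : t ∈ Ico ((k : ℝ) * h) ((k + 1 : ℝ) * h)) :
    (ξ t).snd = (triggerRun f κ fp V γ c σ h ν (samples h ξ) k).xsens := by
  rw [← C.snd_sample hh k]
  exact constant_of_has_deriv_right_zero (f := fun s => (ξ s).snd) (a := (k : ℝ) * h) (b := t)
    (fun s hs => (C.flow_prediction k s ⟨hs.1, hs.2.trans_lt ht.2⟩).continuousWithinAt.mono
      fun r hr => ⟨hr.1, hr.2.trans_lt ht.2⟩)
    (fun s hs => hasDerivWithinAt_Ici_of_Ico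
      (C.flow_prediction k s ⟨hs.1, hs.2.trans ht.2⟩) ⟨hs.1, hs.2.trans ht.2⟩) t ⟨ht.1, le_rfl⟩

theorem continuousOn_fst (k : ℕ) :
    ContinuousOn (fun s => (ξ s).fst) (Icc ((k : ℝ) * h) ((k + 1 : ℝ) * h)) := by
  intro t ht
  rcases ht.2.eq_or_lt with rfl | hlt
  · have h1 : ContinuousWithinAt (fun s => (ξ s).fst) (Iio ((k + 1 : ℝ) * h)) ((k + 1 : ℝ) * h) :=
      C.state_leftLim k
    exact (continuousWithinAt_Iio_iff_Iic.1 h1).mono Icc_subset_Iic_self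
  · refine (C.flow_state k t ⟨ht.1, hlt⟩).continuousWithinAt.mono_of_mem_nhdsWithin ?_
    refine mem_of_superset (inter_mem_nhdsWithin _ (Iio_mem_nhds hlt)) ?_
    exact fun s hs => ⟨hs.1.1, hs.2⟩

theorem hasDerivWithinAt_shift (hh : 0 < h) (k : ℕ) {t : ℝ} (ht : t ∈ Ico 0 h) :
    HasDerivWithinAt (fun s => (ξ ((k : ℝ) * h + s)).fst)
      (f (ξ ((k : ℝ) * h + t)).fst (κ (triggerRun f κ fp V γ c σ h ν (samples h ξ) k).xsens))
      (Ici t) t := by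
  have hmem : (k : ℝ) * h + t ∈ Ico ((k : ℝ) * h) ((k + 1 : ℝ) * h) :=
    ⟨by linarith [ht.1], by linarith [ht.2]⟩
  have h1 := hasDerivWithinAt_Ici_of_Ico (C.flow_state k _ hmem) hmem
  rw [C.snd_eq hh hmem] at h1
  have h2 : HasDerivWithinAt (fun s => (k : ℝ) * h + s) 1 (Ici t) t :=
    ((hasDerivAt_id t).const_add _).hasDerivWithinAt
  have h3 := h1.scomp t h2 fun s hs => mem_Ici.2 (by linarith [mem_Ici.1 hs])
  rw [one_smul] at h3
  exact h3

end IsClosedLoop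

namespace Admissible

variable (A : Admissible f κ V α₁ α₂ γ M c σ h)

include A

theorem trajectory_bound_of_invariant (C : IsClosedLoop f κ fp V γ c σ h ν x₀ ξ) {k : ℕ}
    (I : TriggerInvariant f κ fp V γ c σ h ν (samples h ξ) k
      (triggerRun f κ fp V γ c σ h ν (samples h ξ) k)) :
    ∀ t ∈ Icc 0 h, (ξ ((k : ℝ) * h + t)).fst ∈ levelSet V c ∧
      V (ξ ((k : ℝ) * h + t)).fst ≤ sampleBound f κ V c (samples h ξ k)
        (κ (triggerRun f κ fp V γ c σ h ν (samples h ξ) k).xsens) t := by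
  refine A.mem_levelSet_and_le_sampleBound (x := fun t => (ξ ((k : ℝ) * h + t)).fst)
    (A.isSafeSample I) ?_ (by simp [samples]) fun t ht => C.hasDerivWithinAt_shift A.h_pos k ht
  exact (C.continuousOn_fst k).comp (by fun_prop)
    fun t ht => ⟨by linarith [ht.1], by linarith [ht.2]⟩

theorem le_sampleBound_of_invariant (C : IsClosedLoop f κ fp V γ c σ h ν x₀ ξ) {k : ℕ}
    (I : TriggerInvariant f κ fp V γ c σ h ν (samples h ξ) k
      (triggerRun f κ fp V γ c σ h ν (samples h ξ) k)) :
    V (samples h ξ (k + 1)) ≤ sampleBound f κ V c (samples h ξ k)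
        (κ (triggerRun f κ fp V γ c σ h ν (samples h ξ) k).xsens) h := by
  have h1 := (A.trajectory_bound_of_invariant C I h ⟨A.h_pos.le, le_rfl⟩).2
  have e : ((k + 1 : ℕ) : ℝ) * h = k * h + h := by push_cast; ring
  rwa [samples, e]

theorem triggerInvariant (C : IsClosedLoop f κ fp V γ c σ h ν x₀ ξ) (hx₀ : x₀ ∈ levelSet V c)
    (k : ℕ) : TriggerInvariant f κ fp V γ c σ h ν (samples h ξ) k
      (triggerRun f κ fp V γ c σ h ν (samples h ξ) k) := by
  induction k with
  | zero => exact A.triggerInvariant_zero (C.sample_zero.symm ▸ hx₀)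
  | succ k I => exact A.triggerInvariant_succ I (A.le_sampleBound_of_invariant C I)

/-- Between transmissions `V` decreases below the reference value at rate `σ γ(V^ref)`. -/
theorem trajectory_bound (C : IsClosedLoop f κ fp V γ c σ h ν x₀ ξ) (hx₀ : x₀ ∈ levelSet V c)
    {k : ℕ} {t : ℝ} (ht : t ∈ Icc ((k : ℝ) * h) ((k + 1 : ℝ) * h)) :
    (ξ t).fst ∈ levelSet V c ∧
      V (ξ t).fst ≤ (triggerRun f κ fp V γ c σ h ν (samples h ξ) k).Vref -
        (t - (triggerRun f κ fp V γ c σ h ν (samples h ξ) k).iref * h) *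
          (σ * γ (triggerRun f κ fp V γ c σ h ν (samples h ξ) k).Vref) := by
  have I := A.triggerInvariant C hx₀ k
  have hm : t - k * h ∈ Icc 0 h := ⟨by linarith [ht.1], by linarith [ht.2]⟩
  have h1 := A.trajectory_bound_of_invariant C I _ hm
  have h2 := I.bound _ hm
  rw [add_sub_cancel] at h1
  exact ⟨h1.1, by linarith [h1.2]⟩

theorem le_Vref (C : IsClosedLoop f κ fp V γ c σ h ν x₀ ξ) (hx₀ : x₀ ∈ levelSet V c)
    {k : ℕ} {t : ℝ} (ht : t ∈ Icc ((k : ℝ) * h) ((k + 1 : ℝ) * h)) :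
    V (ξ t).fst ≤ (triggerRun f κ fp V γ c σ h ν (samples h ξ) k).Vref := by
  have I := A.triggerInvariant C hx₀ k
  have h1 := mul_le_mul_of_nonneg_right (TriggerInvariant.cast_le I) A.h_pos.le
  have h2 := mul_nonneg (by linarith [ht.1] : 0 ≤ t -
    (triggerRun f κ fp V γ c σ h ν (samples h ξ) k).iref * h) (A.rate_nonneg I)
  linarith [(A.trajectory_bound C hx₀ ht).2]

theorem Vref_antitone (C : IsClosedLoop f κ fp V γ c σ h ν x₀ ξ) (hx₀ : x₀ ∈ levelSet V c) :
    Antitone fun k => (triggerRun f κ fp V γ c σ h ν (samples h ξ) k).Vref := by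
  refine antitone_nat_of_succ_le fun k => ?_
  have I := A.triggerInvariant C hx₀ k
  rcases A.triggerRun_succ_cases I (A.le_sampleBound_of_invariant C I) with h1 | h1
  · exact h1.2.le
  · exact h1.trans (by linarith [mul_nonneg A.h_pos.le (A.rate_nonneg I)])

/-- A reset lowers the reference by the stated amount, later steps cannot undo this, and a reference
can be kept for at most ν steps. -/
theorem Vref_decrease (C : IsClosedLoop f κ fp V γ c σ h ν x₀ ξ) (hx₀ : x₀ ∈ levelSet V c)
    (k : ℕ) : (triggerRun f κ fp V γ c σ h ν (samples h ξ) (k + (ν + 1))).Vref ≤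
      (triggerRun f κ fp V γ c σ h ν (samples h ξ) k).Vref -
        h * (σ * γ (triggerRun f κ fp V γ c σ h ν (samples h ξ) k).Vref) := by
  set s := triggerRun f κ fp V γ c σ h ν (samples h ξ) with hs
  have key : ∀ j, ((s (k + j)).iref = (s k).iref ∧ (s (k + j)).Vref = (s k).Vref) ∨
      (s (k + j)).Vref ≤ (s k).Vref - h * (σ * γ (s k).Vref) := by
    intro j
    induction j with
    | zero => exact Or.inl ⟨rfl, rfl⟩
    | succ j ih =>
      have I := A.triggerInvariant C hx₀ (k + j)
      rcases ih with ih | ih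
      · rcases A.triggerRun_succ_cases I (A.le_sampleBound_of_invariant C I) with h1 | h1
        · exact Or.inl ⟨h1.1.trans ih.1, h1.2.trans ih.2⟩
        · right
          rw [← hs, ih.2] at h1
          exact h1
      · exact Or.inr ((A.Vref_antitone C hx₀ (Nat.le_succ (k + j))).trans ih)
  rcases key (ν + 1) with h1 | h1
  · exfalso
    have h2 := (A.triggerInvariant C hx₀ (k + (ν + 1))).le_iref_add
    have h3 := (A.triggerInvariant C hx₀ k).iref_le
    rw [← hs] at h2 h3
    omega
  · exact h1

theorem tendsto_Vref (C : IsClosedLoop f κ fp V γ c σ h ν x₀ ξ) (hx₀ : x₀ ∈ levelSet V c) :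
    Tendsto (fun k => (triggerRun f κ fp V γ c σ h ν (samples h ξ) k).Vref) atTop (𝓝 0) := by
  refine tendsto_zero_of_decrease (g := fun r => h * (σ * γ r)) (N := ν + 1)
    (A.Vref_antitone C hx₀) (fun k => (A.Vref_mem (A.triggerInvariant C hx₀ k)).1) ?_ ?_
    (A.Vref_decrease C hx₀)
  · intro a ha b hb hab
    have h1 := A.lyap.classK_γ.strictMonoOn.monotoneOn ha hb hab
    exact mul_le_mul_of_nonneg_left (mul_le_mul_of_nonneg_left h1 A.σ_mem.1.le) A.h_pos.le
  · exact fun r hr => mul_pos A.h_pos (mul_pos A.σ_mem.1 (A.lyap.classK_γ.pos hr))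

/-- The comparison criterion, without the time shift. -/
theorem le_comparisonSolution (C : IsClosedLoop f κ fp V γ c σ h ν x₀ ξ)
    (hx₀ : x₀ ∈ levelSet V c) {S : ℝ → ℝ} (hS : IsComparisonSolution γ σ (V x₀) S) {t : ℝ}
    (ht : 0 ≤ t) : V (ξ t).fst ≤ S t := by
  have hγ := A.lyap.classK_γ
  have hσ := A.σ_mem.1.le
  have href : ∀ k, (triggerRun f κ fp V γ c σ h ν (samples h ξ) k).Vref ≤
      S ((triggerRun f κ fp V γ c σ h ν (samples h ξ) k).iref * h) := by
    intro k
    induction k using Nat.strong_induction_on with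
    | _ k ih =>
      have I := A.triggerInvariant C hx₀ k
      rw [← I.Vref_eq]
      rcases hi : (triggerRun f κ fp V γ c σ h ν (samples h ξ) k).iref with _ | j
      · rw [C.sample_zero, Nat.cast_zero, zero_mul, hS.init]
      · have hj : j < k := by
          have := I.iref_le
          omega
        have J := A.triggerInvariant C hx₀ j
        have h1 := mul_le_mul_of_nonneg_right (TriggerInvariant.cast_le J) A.h_pos.le
        have h2 : (j : ℝ) * h ≤ ((j + 1 : ℕ) : ℝ) * h := by
          push_cast
          linarith [A.h_pos]
        -- The time (j + 1) h of the reset is also the right end of period j, where the reference in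
        -- force before the reset still bounds V.
        refine (A.trajectory_bound C hx₀ (k := j) ⟨h2, by push_cast; rfl⟩).2.trans ?_
        exact hS.affine_le hγ hσ (mul_nonneg (Nat.cast_nonneg _) A.h_pos.le) (h1.trans h2)
          (A.Vref_mem J).1 (ih j hj)
  have hm := exists_mem_Ico_mul A.h_pos ht
  set k := ⌊t / h⌋₊
  have I := A.triggerInvariant C hx₀ k
  have h1 := mul_le_mul_of_nonneg_right (TriggerInvariant.cast_le I) A.h_pos.le
  exact (A.trajectory_bound C hx₀ ⟨hm.1, hm.2.le⟩).2.trans <|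
    hS.affine_le hγ hσ (mul_nonneg (Nat.cast_nonneg _) A.h_pos.le) (h1.trans hm.1)
      (A.Vref_mem I).1 (href k)

/-! ### Stability and attractivity -/

theorem norm_lt_of_lt {x : Vec n} (hx : x ∈ levelSet V c) {r : ℝ} (hr : 0 ≤ r)
    (hV : V x < α₁ r) : ‖x‖ < r := by
  by_contra! hle
  have h1 := A.lyap.classK_α₁.strictMonoOn.monotoneOn (mem_Ici.2 hr)
    (mem_Ici.2 (norm_nonneg x)) hle
  linarith [A.lyap.lower x hx]

omit A in
theorem norm_pair_le (z : PairState n) : ‖z‖ ≤ ‖z.fst‖ + ‖z.snd‖ := by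
  rw [WithLp.prod_norm_eq_of_L2]
  exact Real.sqrt_le_iff.2 ⟨by positivity, by nlinarith [norm_nonneg z.fst, norm_nonneg z.snd]⟩

omit A in
-- Each of the finitely many iterates is continuous and fixes 0; ν bounds the age of a prediction.
theorem exists_radius_iterate (hfp : Continuous fp) (hfp0 : fp 0 = 0) (ν : ℕ) {ε : ℝ}
    (hε : 0 < ε) : ∃ r > 0, ∀ x, ‖x‖ < r → ∀ j ≤ ν, ‖fp^[j] x‖ < ε := by
  have h1 : ∀ᶠ x in 𝓝 (0 : Vec n), ∀ j ∈ Finset.range (ν + 1), ‖fp^[j] x‖ < ε := by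
    refine (Filter.eventually_all_finset _).2 fun j _ => ?_
    have h2 : Continuous fun x => ‖fp^[j] x‖ := (hfp.iterate j).norm
    refine (h2.tendsto 0).eventually (gt_mem_nhds ?_)
    rw [Function.iterate_fixed hfp0, norm_zero]
    exact hε
  obtain ⟨r, hr, hball⟩ := Metric.eventually_nhds_iff.1 h1
  exact ⟨r, hr, fun x hx j hj =>
    hball (by rwa [dist_zero_right]) j (Finset.mem_range.2 (Nat.lt_succ_of_le hj))⟩

/-- The full state is small as long as the reference value is. -/
theorem exists_Vref_bound (hfp : Continuous fp) (hfp0 : fp 0 = 0) (ν : ℕ) {ε : ℝ} (hε : 0 < ε) :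
    ∃ η > 0, ∀ x₀ ∈ levelSet V c, ∀ ξ, IsClosedLoop f κ fp V γ c σ h ν x₀ ξ →
      ∀ k, (triggerRun f κ fp V γ c σ h ν (samples h ξ) k).Vref < η →
        ∀ t ∈ Ico ((k : ℝ) * h) ((k + 1 : ℝ) * h), ‖ξ t‖ < ε := by
  obtain ⟨r, hr, hiter⟩ := exists_radius_iterate hfp hfp0 ν (half_pos hε)
  refine ⟨α₁ r, A.lyap.classK_α₁.pos hr, fun x₀ hx₀ ξ C k hk t ht => ?_⟩
  have I := A.triggerInvariant C hx₀ k
  have h1 : ‖(ξ t).fst‖ < r := A.norm_lt_of_lt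
    (A.trajectory_bound C hx₀ ⟨ht.1, ht.2.le⟩).1 hr.le
    ((A.le_Vref C hx₀ ⟨ht.1, ht.2.le⟩).trans_lt hk)
  have h2 := A.norm_lt_of_lt (A.triggerInvariant C hx₀ _).sample_mem hr.le (I.Vref_eq.trans_lt hk)
  -- The zeroth iterate shows that the radius r itself enforces ε / 2.
  have h3 : ‖(ξ t).fst‖ < ε / 2 := hiter _ h1 0 (Nat.zero_le _)
  have h4 : ‖(ξ t).snd‖ < ε / 2 := by
    rw [C.snd_eq A.h_pos ht, I.xsens_eq]
    exact hiter _ h2 _ (Nat.sub_le_iff_le_add'.2 I.le_iref_add)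
  linarith [norm_pair_le (ξ t)]

theorem stable (hfp : Continuous fp) (hfp0 : fp 0 = 0) (ν : ℕ) {ε : ℝ} (hε : 0 < ε) :
    ∃ δ > 0, ∀ x₀ ξ, IsClosedLoop f κ fp V γ c σ h ν x₀ ξ → ‖pair x₀ x₀‖ ≤ δ →
      ∀ t, 0 ≤ t → ‖ξ t‖ ≤ ε := by
  obtain ⟨η, hη, H⟩ := A.exists_Vref_bound hfp hfp0 ν hε
  -- The bound c places x₀ in the level set, and η bounds the initial reference, which then never
  -- increases.
  have h1 : ∀ᶠ x in 𝓝 (0 : Vec n), V x < min η c :=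
    (A.lyap.continuous.tendsto 0).eventually
      (gt_mem_nhds (by rw [A.lyap.map_zero]; exact lt_min hη A.c_pos))
  obtain ⟨δ, hδ, hball⟩ := Metric.eventually_nhds_iff.1 h1
  refine ⟨δ / 2, half_pos hδ, fun x₀ ξ C hx₀ t ht => ?_⟩
  have h2 : ‖x₀‖ ≤ ‖pair x₀ x₀‖ := by
    rw [WithLp.prod_norm_eq_of_L2]
    exact Real.le_sqrt_of_sq_le (by simp [pair])
  have h3 := hball (show dist x₀ 0 < δ by rw [dist_zero_right]; linarith)
  have hmem : x₀ ∈ levelSet V c := (h3.trans_le (min_le_right _ _)).le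
  refine (H x₀ hmem ξ C _ ?_ t (exists_mem_Ico_mul A.h_pos ht)).le
  refine (A.Vref_antitone C hmem (Nat.zero_le _)).trans_lt ?_
  change V (samples h ξ 0) < η
  rw [C.sample_zero]
  exact h3.trans_le (min_le_left _ _)

theorem attractive (hfp : Continuous fp) (hfp0 : fp 0 = 0)
    (C : IsClosedLoop f κ fp V γ c σ h ν x₀ ξ) (hx₀ : x₀ ∈ levelSet V c) :
    Tendsto ξ atTop (𝓝 0) := by
  refine Metric.tendsto_nhds.2 fun ε hε => ?_
  obtain ⟨η, hη, H⟩ := A.exists_Vref_bound hfp hfp0 ν hε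
  have h1 : Tendsto (fun t : ℝ => ⌊t / h⌋₊) atTop atTop :=
    tendsto_nat_floor_atTop.comp (tendsto_id.atTop_div_const A.h_pos)
  filter_upwards [h1.eventually ((A.tendsto_Vref C hx₀).eventually (gt_mem_nhds hη)),
    eventually_ge_atTop 0] with t ht ht0
  rw [dist_zero_right]
  exact H x₀ hx₀ ξ C _ ht t (exists_mem_Ico_mul A.h_pos ht0)

end Admissible

end

/-! ### Existence of closed-loop trajectories -/

section

variable {n m : ℕ} {f : Vec n → Vec m → Vec n} {κ : Vec n → Vec m} {fp : Vec n → Vec n}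
  {V : Vec n → ℝ} {α₁ α₂ γ : ℝ → ℝ} {M : Vec n → ℝ} {c σ h : ℝ} {ν : ℕ} {x₀ : Vec n}

open Classical in
/-- One step of the trigger mechanism at the sampling instant `(k + 1)h` with the sample `y`. -/
noncomputable def triggerStep (f : Vec n → Vec m → Vec n) (κ : Vec n → Vec m)
    (fp : Vec n → Vec n) (V : Vec n → ℝ) (γ : ℝ → ℝ) (c σ h : ℝ) (ν k : ℕ) (s : TriggerState n)
    (y : Vec n) : TriggerState n :=
  if triggers f κ V γ c σ h ν (k + 1) s.iref s.Vref y (fp s.xsens) then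
    ⟨k + 1, V y, y, True⟩
  else ⟨s.iref, s.Vref, fp s.xsens, False⟩

/-- The samples may be generated together with the memory of the trigger mechanism. -/
theorem exists_samples (f : Vec n → Vec m → Vec n) (κ : Vec n → Vec m)
    (fp : Vec n → Vec n) (V : Vec n → ℝ) (γ : ℝ → ℝ) (c σ h : ℝ) (ν : ℕ) (x₀ : Vec n)
    (F : Vec n → Vec n → Vec n) :
    ∃ y : ℕ → Vec n, y 0 = x₀ ∧
      ∀ k, y (k + 1) = F (y k) (triggerRun f κ fp V γ c σ h ν y k).xsens := by
  -- `triggerRun` takes the whole sample sequence, while each new sample depends on the memory at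
  -- the previous step; a joint recursion removes the circularity.
  let Z : ℕ → Vec n × TriggerState n := fun k => Nat.rec (x₀, ⟨0, V x₀, x₀, True⟩)
    (fun k z => (F z.1 z.2.xsens, triggerStep f κ fp V γ c σ h ν k z.2 (F z.1 z.2.xsens))) k
  have hrun : ∀ k, triggerRun f κ fp V γ c σ h ν (fun k => (Z k).1) k = (Z k).2 := by
    intro k
    induction k with
    | zero => rfl
    | succ k ih =>
      change triggerStep f κ fp V γ c σ h ν k
        (triggerRun f κ fp V γ c σ h ν (fun k => (Z k).1) k) (Z (k + 1)).1 = _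
      rw [ih]
  refine ⟨fun k => (Z k).1, rfl, fun k => ?_⟩
  rw [hrun]

namespace Admissible

variable (A : Admissible f κ V α₁ α₂ γ M c σ h)

include A

theorem exists_isClosedLoop (fp : Vec n → Vec n) (ν : ℕ) (hx₀ : x₀ ∈ levelSet V c) :
    ∃ ξ, IsClosedLoop f κ fp V γ c σ h ν x₀ ξ := by
  have hh := A.h_pos
  -- Safety is placed under the existential so that a total flow φ can be chosen before the samples,
  -- whose safety is proved only afterwards, exist.
  have hflow : ∀ y xs : Vec n, ∃ x : ℝ → Vec n, IsSafeSample f κ V c h y xs → x 0 = y ∧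
      ∀ t ∈ Icc 0 h, HasDerivWithinAt x (f (x t) (κ xs)) (Icc 0 h) t := by
    intro y xs
    by_cases S : IsSafeSample f κ V c h y xs
    · obtain ⟨x, hx⟩ := A.exists_flow S
      exact ⟨x, fun _ => hx⟩
    · exact ⟨fun _ => y, fun S' => absurd S' S⟩
  choose φ hφ using hflow
  obtain ⟨y, y0, hy⟩ := exists_samples f κ fp V γ c σ h ν x₀ fun a b => φ a b h
  set s := triggerRun f κ fp V γ c σ h ν y with hs
  have hle : ∀ k, IsSafeSample f κ V c h (y k) (s k).xsens →
      V (y (k + 1)) ≤ sampleBound f κ V c (y k) (κ (s k).xsens) h := by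
    intro k S
    obtain ⟨h0, hd⟩ := hφ _ _ S
    rw [hy k]
    exact (A.mem_levelSet_and_le_sampleBound S (fun t ht => (hd t ht).continuousWithinAt) h0
      (fun t ht => hasDerivWithinAt_Ici_of_Ico
        ((hd t ⟨ht.1, ht.2.le⟩).mono Ico_subset_Icc_self) ht) h ⟨hh.le, le_rfl⟩).2
  have hinv : ∀ k, TriggerInvariant f κ fp V γ c σ h ν y k (s k) := by
    intro k
    induction k with
    | zero => exact A.triggerInvariant_zero (y0 ▸ hx₀)
    | succ k I => exact A.triggerInvariant_succ I (hle k (A.isSafeSample I))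
  have hsol := fun k => hφ _ _ (A.isSafeSample (hinv k))
  set ξ : ℝ → PairState n := fun t =>
    pair (φ (y ⌊t / h⌋₊) (s ⌊t / h⌋₊).xsens (t - ⌊t / h⌋₊ * h)) (s ⌊t / h⌋₊).xsens with hξ
  have hξ_eq : ∀ (k : ℕ), ∀ t ∈ Ico ((k : ℝ) * h) ((k + 1 : ℝ) * h),
      ξ t = pair (φ (y k) (s k).xsens (t - k * h)) (s k).xsens := by
    intro k t ht
    simp only [hξ, floor_div_eq hh ht]
  have hleft : ∀ k : ℕ, (k : ℝ) * h ∈ Ico ((k : ℝ) * h) ((k + 1 : ℝ) * h) := fun k =>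
    ⟨le_rfl, by linarith⟩
  have hξ_sample : ∀ k : ℕ, ξ ((k : ℝ) * h) = pair (y k) (s k).xsens := by
    intro k
    rw [hξ_eq k _ (hleft k), sub_self, (hsol k).1]
  have hξ_succ : ∀ k : ℕ, ξ ((k + 1 : ℝ) * h) = pair (y (k + 1)) (s (k + 1)).xsens := by
    intro k
    rw [← hξ_sample (k + 1)]
    push_cast
    rfl
  have hsamples : (fun k : ℕ => (ξ ((k : ℝ) * h)).fst) = y := by
    funext k
    rw [hξ_sample k]
    rfl
  have hshift : ∀ k : ℕ, ∀ t ∈ Icc ((k : ℝ) * h) ((k + 1 : ℝ) * h),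
      HasDerivWithinAt (fun r => φ (y k) (s k).xsens (r - k * h))
        (f (φ (y k) (s k).xsens (t - k * h)) (κ (s k).xsens))
        (Icc ((k : ℝ) * h) ((k + 1 : ℝ) * h)) t := by
    intro k t ht
    have hmaps : ∀ r ∈ Icc ((k : ℝ) * h) ((k + 1 : ℝ) * h), r - k * h ∈ Icc 0 h := fun r hr =>
      ⟨by linarith [hr.1], by linarith [hr.2]⟩
    have h1 := ((hsol k).2 _ (hmaps t ht)).scomp t
      ((hasDerivAt_id t).sub_const ((k : ℝ) * h)).hasDerivWithinAt hmaps
    rw [one_smul] at h1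
    exact h1
  refine ⟨ξ, ?_⟩
  rw [IsClosedLoop, hsamples]
  refine ⟨?_, fun k t ht => ?_, fun k t ht => ?_, fun k => ?_, fun k hk => ?_, fun k hk => ?_⟩
  · have h1 := hξ_sample 0
    rw [Nat.cast_zero, zero_mul] at h1
    rw [h1, y0]
    change pair x₀ (y 0) = _
    rw [y0]
  · have h1 := (hshift k t ⟨ht.1, ht.2.le⟩).mono Ico_subset_Icc_self
    rw [hξ_eq k t ht]
    exact h1.congr (fun r hr => by rw [hξ_eq k r hr]; rfl) (by rw [hξ_eq k t ht]; rfl)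
  · exact (hasDerivWithinAt_const t _ (s k).xsens).congr (fun r hr => by rw [hξ_eq k r hr]; rfl)
      (by rw [hξ_eq k t ht]; rfl)
  · have hlt : (k : ℝ) * h < (k + 1 : ℝ) * h := by linarith
    have h1 := (hshift k _ (right_mem_Icc.2 hlt.le)).continuousWithinAt.mono Ico_subset_Icc_self
    have h2 : Tendsto (fun r => φ (y k) (s k).xsens (r - k * h)) (𝓝[<] ((k + 1 : ℝ) * h))
        (𝓝 (φ (y k) (s k).xsens ((k + 1 : ℝ) * h - k * h))) := by
      rw [← nhdsWithin_Ico_eq_nhdsLT hlt]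
      exact h1
    have h3 : (ξ ((k + 1 : ℝ) * h)).fst = φ (y k) (s k).xsens ((k + 1 : ℝ) * h - k * h) := by
      rw [hξ_succ k, show ((k : ℝ) + 1) * h - k * h = h by ring, ← hy k]
      rfl
    rw [h3]
    refine h2.congr' ?_
    filter_upwards [Ico_mem_nhdsLT hlt] with r hr
    rw [hξ_eq k r hr]
    rfl
  · rw [mem_transmissionTimes_iff hh] at hk
    by_cases H : triggers f κ V γ c σ h ν (k + 1) (s k).iref (s k).Vref (y (k + 1))
        (fp (s k).xsens)
    · exact absurd (by rw [triggerRun_succ_of_triggers H]; trivial) hk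
    · rw [hξ_succ, hξ_sample, hs, triggerRun_succ_of_not_triggers H]
      rfl
  · rw [mem_transmissionTimes_iff hh] at hk
    by_cases H : triggers f κ V γ c σ h ν (k + 1) (s k).iref (s k).Vref (y (k + 1))
        (fp (s k).xsens)
    · rw [hξ_succ, hs, triggerRun_succ_of_triggers H]
      rfl
    · rw [triggerRun_succ_of_not_triggers H] at hk
      exact hk.elim

theorem levelSet_mem_nhds : levelSet V c ∈ 𝓝 (0 : Vec n) :=
  ((A.lyap.continuous.tendsto 0).eventually
    (gt_mem_nhds (by rw [A.lyap.map_zero]; exact A.c_pos))).mono fun _ hx => le_of_lt hx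

end Admissible

end

end PETC

/-! ### The main theorem -/

theorem theorem1 {n m : ℕ}
    (f : PETC.Vec n → PETC.Vec m → PETC.Vec n) (hf : f 0 0 = 0)
    (κ : PETC.Vec n → PETC.Vec m)
    (V : PETC.Vec n → ℝ) (α₁ α₂ γ : ℝ → ℝ) (M : PETC.Vec n → ℝ)
    (c : ℝ) (hc : 0 < c)
    (hLyap : PETC.LyapunovAssumption f κ V α₁ α₂ γ c)
    (hL₁ : BddAbove (PETC.quotients₁ f κ V c))
    (hL₂ : BddAbove (PETC.quotients₂ V c))
    (hM : PETC.GrowthAssumption f κ V M c)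
    (σ : ℝ) (hσ : σ ∈ Set.Ioo (0 : ℝ) 1)
    (h : ℝ) (h_pos : 0 < h) (h_le : h ≤ PETC.hMASP f κ V M c σ)
    (ν : ℕ) (hν : 0 < ν)
    (fp : PETC.Vec n → PETC.Vec n) (hfp : ContDiff ℝ 1 fp) (hfp0 : fp 0 = 0) :
    PETC.IsLocallyAsymptoticallyStable (PETC.IsClosedLoop f κ fp V γ c σ h ν)
        (PETC.levelSet V c) ∧
      ∀ x₀ ∈ PETC.levelSet V c, ∀ ξ, PETC.IsClosedLoop f κ fp V γ c σ h ν x₀ ξ →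
        ∀ S, PETC.IsComparisonSolution γ σ (V x₀) S →
          ∀ t, 0 < t → V (ξ (t + h)).fst ≤ S t := by
  have A : PETC.Admissible f κ V α₁ α₂ γ M c σ h := ⟨hc, hLyap, hL₁, hL₂, hM, hσ, h_pos, h_le⟩
  refine ⟨⟨A.levelSet_mem_nhds, fun x₀ hx₀ => A.exists_isClosedLoop fp ν hx₀,
    fun ε hε => A.stable hfp.continuous hfp0 ν hε,
    fun x₀ hx₀ ξ C => A.attractive hfp.continuous hfp0 C hx₀⟩, ?_⟩
  intro x₀ hx₀ ξ C S hS t ht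
  have hth : 0 ≤ t + h := by linarith
  -- The comparison holds already without the shift, V(x(t + h)) ≤ S(t + h), and S is nonincreasing.
  exact (A.le_comparisonSolution C hx₀ hS hth).trans <|
    hS.antitoneOn hLyap.classK_γ hσ.1.le (Set.mem_Ici.2 ht.le) (Set.mem_Ici.2 hth) (by linarith)
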